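/- Let $abcd$ be a regular tetrahedron in $\mathbb{R}^3$ with sides of length $2$. **Definitions.** A *parabolic pea pod* $\Sigma$ with beam $ab$ is given by a point $c_\Sigma$ that is equidistant from $a$ and $b$ and is not on the line $ab$. Let $H_\Sigma$ be the plane through $a,b,c_\Sigma$, let $r_\Sigma=|c_\Sigma a|$, let the *principal circle* be the circle in $H_\Sigma$ with center $c_\Sigma$ and radius $r_\Sigma$, and let the *axis* be the line through $c_\Sigma$ and the midpoint of $ab$. Let $E(\Sigma)$ be the set of the centers $x$ of the disks in $H_\Sigma$ (of radius $R(x)\ge 0$) that lie inside the principal circle, are tangent to it and to the line $ab$, and lie in the half plane of $H_\Sigma$ bounded by the line $ab$ opposite to $c_\Sigma$. These centers lie on a parabola in $H_\Sigma$ with focus $c_\Sigma$, the *pea string* $C_\Sigma$, whose directrix is the line parallel to $ab$ at distance $r_\Sigma$ from it on the side opposite to $c_\Sigma$. Two such pea pods $\Sigma_1,\Sigma_2$ are *confocal* if they have the same axis, their planes are orthogonal, and each of the parabolas $C_{\Sigma_1},C_{\Sigma_2}$ contains the focus of the other; they are *convex confocal* if moreover $c_{\Sigma_1}$ is the point of $E(\Sigma_2)$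 on the axis and $c_{\Sigma_2}$ is the point of $E(\Sigma_1)$ on the axis. For points $x\ne y$ let $\varphi_\Sigma(x,y)$ be the point of the line $xy$ at distance $R(x)$ from $x$ for which $x$ is between it and $y$. Choose convex confocal parabolic pea pods on each of the three pairs of opposite edges of $abcd$. For a chosen confocal pair $\Sigma_1,\Sigma_2$ with beams $ab,cd$, the *wedge-pod surfaces* are $(AB)=\{\varphi_{\Sigma_1}(x,y): x\in E(\Sigma_1),\,y\in E(\Sigma_2)\}$ and $(CD)=\{\varphi_{\Sigma_2}(y,x): x\in E(\Sigma_1),\,y\in E(\Sigma_2)\}$, and the surfaces $(AC),(BD),(AD),(BC)$ are defined in the same way. For a vertex $v$ and the pea pod $\Sigma$ of an edge $e$ not containing $v$, the points $\varphi_{\Sigma}(x,v)$, $x\in E(\Sigma)$, form a curve on the sphere $\mathbb S(v,2)$ that joins the ends of $e$. For each $v$ let the *cap* of $v$ be the part of $\mathbb S(v,2)$ that is bounded by the union of the three such curves and is contained in the boundary of the Reuleaux tetrahedron (the intersection of the four balls of radius $2$ with centers $a,b,c,d$). Let $\Im$ be the union of the six wedge-pod surfaces and the four caps. *Robert's body*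 $\mathcal R$ is the body $\operatorname{conv}(\Im)$. **Statement.** 1. There is exactly one pair of convex confocal parabolic pea pods with beams $ab$ and $cd$ (and hence, by relabelling, on each pair of opposite edges). 2. Consequently Robert's body $\mathcal R$ of $abcd$ exists and is unique. 3. $\mathcal R$ has the full symmetry group of the regular tetrahedron $abcd$: an isometry $g$ of $\mathbb{R}^3$ satisfies $g(\mathcal R)=\mathcal R$ if and only if it maps the tetrahedron $abcd$ onto itself. -/

import Mathlib

noncomputable section

namespace Peabody

/-- Euclidean three-space. -/
abbrev E3 : Type := EuclideanSpace ℝ (Fin 3)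

/-- The parabola in the plane `H` with focus `F` and directrix `D`. -/
def parabola (H : AffineSubspace ℝ E3) (F : E3) (D : AffineSubspace ℝ E3) : Set E3 :=
  {x | x ∈ H ∧ dist x F = Metric.infDist x (D : Set E3)}

/-- A parabolic pea pod frame with longitudinal beam `ab`: one of its two circles is the line
through `ab`, and the other one, the principal circle, has `ab` as a chord, so that it is given by
its center.  The center is not on the beam, as there has to be a half plane opposite to it. -/
@[ext]
structure ParabolicPeaPod (a b : E3) where
  center : E3
  ends_ne : a ≠ b
  dist_ends : dist center a = dist center b
  center_ne : center ≠ midpoint ℝ a b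

namespace ParabolicPeaPod

variable {a b : E3}

/-- The radius of the principal circle. -/
def radius (S : ParabolicPeaPod a b) : ℝ := dist S.center a

/-- The plane of the frame. -/
def plane (S : ParabolicPeaPod a b) : AffineSubspace ℝ E3 := affineSpan ℝ {a, b, S.center}

/-- The axis: the line through the center of the principal circle that is perpendicular to the
beam and meets it in its midpoint. -/
def axis (S : ParabolicPeaPod a b) : AffineSubspace ℝ E3 :=
  affineSpan ℝ {S.center, midpoint ℝ a b}

/-- The line that contains the beam. -/
def beamLine (_S : ParabolicPeaPod a b) : AffineSubspace ℝ E3 := affineSpan ℝ {a, b}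

/-- The radius of a disk of the frame's plane with center `x` that is tangent to the beam. -/
def peaRadius (S : ParabolicPeaPod a b) (x : E3) : ℝ := Metric.infDist x (S.beamLine : Set E3)

/-- The set of the centers of the disks (those of radius zero included) in the plane of the frame
that lie inside the principal circle, are tangent to it and to the beam, and are in the half plane
opposite to the center of the principal circle. -/
def arc (S : ParabolicPeaPod a b) : Set E3 :=
  {x | x ∈ S.plane ∧ S.beamLine.WOppSide S.center x ∧
    dist x S.center + S.peaRadius x = S.radius}

/-- The parallel to the beam at distance `radius` from it, on the side opposite to `center`. -/
def directrix (S : ParabolicPeaPod a b) : AffineSubspace ℝ E3 :=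
  AffineSubspace.mk'
    (midpoint ℝ a b +
      (S.radius / dist (midpoint ℝ a b) S.center) • (midpoint ℝ a b - S.center))
    S.beamLine.direction

/-- The parabolic pea string: the parabola, with focus at the center of the principal circle, on
which the centers of the disks lie. -/
def peaString (S : ParabolicPeaPod a b) : Set E3 := parabola S.plane S.center S.directrix

/-- `x` is the center of the bulb: the pea whose center lies on the axis. -/
def IsBulbCenter (S : ParabolicPeaPod a b) (x : E3) : Prop := x ∈ S.arc ∧ x ∈ S.axis

/-- The point of the line through `x` and `y` at distance `peaRadius x` from `x` for which `x` is
between it and `y`. -/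
def outer (S : ParabolicPeaPod a b) (x y : E3) : E3 := x + (S.peaRadius x / dist x y) • (x - y)

/-- The curve `{φ(x, v) : x ∈ E(S)}` from `a` to `b` determined by the vertex `v`. -/
def edgeCurve (S : ParabolicPeaPod a b) (v : E3) : Set E3 := (fun x => S.outer x v) '' S.arc

end ParabolicPeaPod

variable {a b c d : E3}

/-- Confocal pea pods: the axes agree, the planes are orthogonal (their normals are), and the pea
strings are confocal, that is, each of the two parabolas contains the focus of the other. -/
structure IsConfocal (S : ParabolicPeaPod a b) (T : ParabolicPeaPod c d) : Prop where
  axis_eq : S.axis = T.axis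
  planes_orthogonal : S.plane.directionᗮ ⟂ T.plane.directionᗮ
  left_focus_mem : S.center ∈ T.peaString
  right_focus_mem : T.center ∈ S.peaString

/-- Convex confocal pea pods: moreover, the center of the principal circle of each of them is the
center of the bulb of the other. -/
structure IsConvexConfocal (S : ParabolicPeaPod a b) (T : ParabolicPeaPod c d) : Prop
    extends IsConfocal S T where
  left_center_bulb : T.IsBulbCenter S.center
  right_center_bulb : S.IsBulbCenter T.center

/-- The wedge-pod surface of `S` in the confocal pair `S`, `T`; the other wedge-pod surface of the
pair is `wedgePod T S`. -/
def wedgePod (S : ParabolicPeaPod a b) (T : ParabolicPeaPod c d) : Set E3 :=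
  Set.image2 S.outer S.arc T.arc

/-- A regular tetrahedron with sides of length `2`. -/
structure IsRegularTetrahedron (a b c d : E3) : Prop where
  ab : dist a b = 2
  ac : dist a c = 2
  ad : dist a d = 2
  bc : dist b c = 2
  bd : dist b d = 2
  cd : dist c d = 2

/-- The solid tetrahedron. -/
def tetrahedron (a b c d : E3) : Set E3 := convexHull ℝ {a, b, c, d}

/-- The Reuleaux tetrahedron over a regular tetrahedron with sides of length `2`. -/
def reuleaux (a b c d : E3) : Set E3 :=
  Metric.closedBall a 2 ∩ Metric.closedBall b 2 ∩ Metric.closedBall c 2 ∩ Metric.closedBall d 2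

/-- The cap of the sphere with center `v` and radius `2` that is bounded by the closed curve `Γ`
and is contained in the boundary of `T`: the curve together with what it bounds in `∂T`. -/
def cap (T : Set E3) (v : E3) (Γ : Set E3) : Set E3 :=
  Γ ∪ {p | p ∈ Metric.sphere v 2 \ Γ ∧
    connectedComponentIn (Metric.sphere v 2 \ Γ) p ⊆ frontier T}

/-- A choice of convex confocal pea pods with parabolic pea strings on each of the three pairs of
opposite edges of the tetrahedron `abcd`. -/
structure ParabolicDevices (a b c d : E3) where
  ab : ParabolicPeaPod a b
  cd : ParabolicPeaPod c d
  ac : ParabolicPeaPod a c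
  bd : ParabolicPeaPod b d
  ad : ParabolicPeaPod a d
  bc : ParabolicPeaPod b c
  ab_cd : IsConvexConfocal ab cd
  ac_bd : IsConvexConfocal ac bd
  ad_bc : IsConvexConfocal ad bc

namespace ParabolicDevices

/-- The union of the six wedge-pod surfaces. -/
def wedges (P : ParabolicDevices a b c d) : Set E3 :=
  wedgePod P.ab P.cd ∪ wedgePod P.cd P.ab ∪ wedgePod P.ac P.bd ∪ wedgePod P.bd P.ac ∪
    wedgePod P.ad P.bc ∪ wedgePod P.bc P.ad

/-- The union of the four spherical caps. -/
def caps (P : ParabolicDevices a b c d) : Set E3 :=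
  cap (reuleaux a b c d) a (P.bc.edgeCurve a ∪ P.cd.edgeCurve a ∪ P.bd.edgeCurve a) ∪
  cap (reuleaux a b c d) b (P.cd.edgeCurve b ∪ P.ad.edgeCurve b ∪ P.ac.edgeCurve b) ∪
  cap (reuleaux a b c d) c (P.ab.edgeCurve c ∪ P.bd.edgeCurve c ∪ P.ad.edgeCurve c) ∪
  cap (reuleaux a b c d) d (P.ab.edgeCurve d ∪ P.bc.edgeCurve d ∪ P.ac.edgeCurve d)

/-- The closed surface assembled from the wedge-pod surfaces and the spherical caps. -/
def surface (P : ParabolicDevices a b c d) : Set E3 := P.wedges ∪ P.caps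

end ParabolicDevices

/-- `R` is the body assembled over `abcd` from parabolic pea pods: the convex hull of the assembled
surface. -/
def IsRobertsBody (a b c d : E3) (R : Set E3) : Prop :=
  ∃ P : ParabolicDevices a b c d, R = convexHull ℝ P.surface

end Peabody

end

noncomputable section

namespace Peabody

/-! ### Coordinates in the plane of a pea pod -/

/-! Put h = √2/2 and take orthonormal coordinates in which the vertices are (±1, 0, h) and (0, ±1,
-h). In a convex confocal pair both axes pass through the midpoints of `ab` and `cd`, so both
centers lie on the third coordinate axis. That each center is the bulb center of the other gives two
quadratic equations for their heights. Together with the sign conditions they leave only the heights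
∓(h + 1)/2 (`TetraCoords.center_eq`), and these do give a convex confocal pair
(`TetraCoords.isConvexConfocal`). Since a pea pod is determined by its center, the pair is unique;
hence so are the devices on all three pairs of opposite edges, and with them the body.

An isometry that permutes the vertices carries the body to the body of the relabelled tetrahedron
(`IsRobertsBody.map`). Relabelling does not change the body (`IsRobertsBody.perm`), so by uniqueness
the body is preserved.

For the converse, the assembled surface meets the circumscribed sphere, of radius √(3/2), in the
four vertices only and otherwise lies inside it. For the wedge-pod surfaces this is an explicit
distance formula (`TetraCoords.dist_outer`). The caps consist of curves on those surfaces and of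
points of the Reuleaux tetrahedron, for which it is an elementary estimate
(`TetraCoords.dist_of_mem_reuleaux`). By strict convexity of the ball the convex hull meets the
sphere in the same four points. The circumscribed ball is the only ball of its radius that contains
the vertices, so an isometry preserving the hull fixes its center and permutes the vertices
(`IsRegularTetrahedron.image_vertices`). -/

/-- Two orthogonal unit vectors. -/
structure IsOrthoPair (e f : E3) : Prop where
  norm_left : ‖e‖ = 1
  norm_right : ‖f‖ = 1
  inner_eq : inner ℝ e f = 0

namespace IsOrthoPair

variable {e f : E3}

theorem norm_sq (h : IsOrthoPair e f) (s t : ℝ) : ‖s • e + t • f‖ ^ 2 = s ^ 2 + t ^ 2 := by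
  rw [norm_add_sq_real, norm_smul, norm_smul, inner_smul_left, inner_smul_right, h.norm_left,
    h.norm_right, h.inner_eq, mul_pow, mul_pow, Real.norm_eq_abs, Real.norm_eq_abs, sq_abs, sq_abs]
  ring

theorem dist_eq (h : IsOrthoPair e f) (m : E3) (s t s' t' : ℝ) :
    dist (m + s • e + t • f) (m + s' • e + t' • f) = √((s - s') ^ 2 + (t - t') ^ 2) := by
  rw [dist_eq_norm, ← h.norm_sq, Real.sqrt_sq (norm_nonneg _)]
  congr 1
  module

theorem neg_right (h : IsOrthoPair e f) : IsOrthoPair e (-f) :=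
  ⟨h.norm_left, by rw [norm_neg, h.norm_right], by rw [inner_neg_right, h.inner_eq, neg_zero]⟩

theorem coord_eq (h : IsOrthoPair e f) {s t s' t' : ℝ}
    (H : s • e + t • f = s' • e + t' • f) : s = s' ∧ t = t' := by
  have h1 : ‖(s - s') • e + (t - t') • f‖ ^ 2 = 0 := by
    rw [show (s - s') • e + (t - t') • f = (s • e + t • f) - (s' • e + t' • f) by module, H,
      sub_self, norm_zero, sq, mul_zero]
  rw [h.norm_sq] at h1
  constructor <;> nlinarith [sq_nonneg (s - s'), sq_nonneg (t - t')]

/-- The distance of a point from a line parallel to `e`. -/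
theorem infDist_eq (h : IsOrthoPair e f) (m : E3) (s t t₀ : ℝ) {D : Set E3}
    (hD : ∀ x, x ∈ D ↔ ∃ s' : ℝ, x = m + s' • e + t₀ • f) :
    Metric.infDist (m + s • e + t • f) D = |t - t₀| := by
  have hs : m + s • e + t₀ • f ∈ D := (hD _).2 ⟨s, rfl⟩
  apply le_antisymm
  · refine (Metric.infDist_le_dist_of_mem hs).trans_eq ?_
    rw [h.dist_eq, sub_self, zero_pow two_ne_zero, zero_add, Real.sqrt_sq_eq_abs]
  · rw [Metric.le_infDist ⟨_, hs⟩]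
    intro y hy
    obtain ⟨s', rfl⟩ := (hD _).1 hy
    rw [h.dist_eq]
    exact Real.abs_le_sqrt (by nlinarith [sq_nonneg (s - s')])

end IsOrthoPair

/-- Coordinates for a pea pod: the beam ends are `m + e` and `m - e`, and the center is
`m - u • f`. -/
structure ParabolicPeaPod.HasCoords {a b : E3} (S : ParabolicPeaPod a b) (m e f : E3) (u : ℝ) :
    Prop extends IsOrthoPair e f where
  left : a = m + e
  right : b = m - e
  center_eq : S.center = m - u • f
  pos : 0 < u

namespace ParabolicPeaPod.HasCoords

variable {a b : E3} {S : ParabolicPeaPod a b} {m e f : E3} {u : ℝ}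

theorem midpoint_eq (h : S.HasCoords m e f u) : midpoint ℝ a b = m := by
  rw [h.left, h.right, midpoint_add_sub]

theorem radius_eq (h : S.HasCoords m e f u) : S.radius = √(1 + u ^ 2) := by
  have := h.dist_eq m 0 (-u) 1 0
  rw [radius, h.center_eq, h.left]
  convert this using 2
  · module
  · module
  · ring

theorem mem_beamLine (h : S.HasCoords m e f u) (x : E3) :
    x ∈ S.beamLine ↔ ∃ s : ℝ, x = m + s • e := by
  rw [beamLine, mem_affineSpan_pair_iff_exists_lineMap_eq]
  constructor
  · rintro ⟨r, rfl⟩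
    refine ⟨1 - 2 * r, ?_⟩
    rw [AffineMap.lineMap_apply, h.left, h.right, vsub_eq_sub, vadd_eq_add]
    module
  · rintro ⟨s, rfl⟩
    refine ⟨(1 - s) / 2, ?_⟩
    rw [AffineMap.lineMap_apply, h.left, h.right, vsub_eq_sub, vadd_eq_add]
    module

theorem peaRadius_eq (h : S.HasCoords m e f u) (s t : ℝ) :
    S.peaRadius (m + s • e + t • f) = |t| := by
  have := h.infDist_eq m s t 0 (D := (S.beamLine : Set E3)) fun x => by
    simp only [SetLike.mem_coe, h.mem_beamLine, zero_smul, add_zero]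
  rwa [sub_zero] at this

theorem mem_axis (h : S.HasCoords m e f u) (x : E3) :
    x ∈ S.axis ↔ ∃ t : ℝ, x = m + t • f := by
  rw [axis, h.midpoint_eq, h.center_eq, mem_affineSpan_pair_iff_exists_lineMap_eq]
  constructor
  · rintro ⟨r, rfl⟩
    refine ⟨(r - 1) * u, ?_⟩
    rw [AffineMap.lineMap_apply, vsub_eq_sub, vadd_eq_add]
    module
  · rintro ⟨t, rfl⟩
    refine ⟨t / u + 1, ?_⟩
    have : t • f = (t / u) • u • f := by rw [smul_smul, div_mul_cancel₀ _ h.pos.ne']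
    rw [AffineMap.lineMap_apply, vsub_eq_sub, vadd_eq_add, this]
    module

theorem dir_mem (h : S.HasCoords m e f u) : e ∈ S.plane.direction ∧ f ∈ S.plane.direction := by
  have ha : a ∈ S.plane := subset_affineSpan ℝ _ (by simp)
  have hb : b ∈ S.plane := subset_affineSpan ℝ _ (by simp)
  have hc : S.center ∈ S.plane := subset_affineSpan ℝ _ (by simp)
  have he := AffineSubspace.vsub_mem_direction ha hb
  have hf := AffineSubspace.vsub_mem_direction ha hc
  rw [vsub_eq_sub] at he hf
  have he' : e ∈ S.plane.direction := by
    rw [show e = (1 / 2 : ℝ) • (a - b) by rw [h.left, h.right]; module]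
    exact Submodule.smul_mem _ _ he
  refine ⟨he', ?_⟩
  have : u • f ∈ S.plane.direction := by
    rw [show u • f = (a - S.center) - e by rw [h.center_eq]; nth_rw 1 [h.left]; module]
    exact Submodule.sub_mem _ hf he'
  exact (Submodule.smul_mem_iff _ h.pos.ne').1 this

theorem mem_plane (h : S.HasCoords m e f u) (x : E3) :
    x ∈ S.plane ↔ ∃ s t : ℝ, x = m + s • e + t • f := by
  constructor
  · intro hx
    have hle : S.plane ≤ AffineSubspace.mk' m (Submodule.span ℝ {e, f}) := by
      refine affineSpan_le.2 ?_
      rintro y (rfl | rfl | rfl) <;>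
        rw [SetLike.mem_coe, AffineSubspace.mem_mk', Submodule.mem_span_pair, vsub_eq_sub]
      · exact ⟨1, 0, by rw [h.left]; module⟩
      · exact ⟨-1, 0, by rw [h.right]; module⟩
      · exact ⟨0, -u, by rw [h.center_eq]; module⟩
    have := hle hx
    rw [AffineSubspace.mem_mk', Submodule.mem_span_pair, vsub_eq_sub] at this
    obtain ⟨s, t, hst⟩ := this
    exact ⟨s, t, by rw [add_assoc, hst, add_sub_cancel]⟩
  · rintro ⟨s, t, rfl⟩
    have ha : a ∈ S.plane := subset_affineSpan ℝ _ (by simp)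
    have := AffineSubspace.vadd_mem_of_mem_direction
      (Submodule.add_mem _ (Submodule.smul_mem _ (s - 1) h.dir_mem.1)
        (Submodule.smul_mem _ t h.dir_mem.2)) ha
    convert this using 1
    rw [h.left, vadd_eq_add]
    module

theorem wOppSide_iff (h : S.HasCoords m e f u) (s t : ℝ) :
    S.beamLine.WOppSide S.center (m + s • e + t • f) ↔ 0 ≤ t := by
  have hf : inner ℝ f f = (1 : ℝ) := by rw [real_inner_self_eq_norm_sq, h.norm_right, one_pow]
  have hef : inner ℝ f e = (0 : ℝ) := by rw [real_inner_comm, h.inner_eq]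
  constructor
  · rintro ⟨p, hp, q, hq, hpq⟩
    obtain ⟨p, rfl⟩ := (h.mem_beamLine _).1 hp
    obtain ⟨q, rfl⟩ := (h.mem_beamLine _).1 hq
    -- Projecting to the direction `f` forgets the choice of points on the beam and leaves the
    -- numbers `-u` and `-t` on a common ray.
    have h1 := hpq.map (innerₛₗ ℝ f)
    rw [h.center_eq] at h1
    simp only [vsub_eq_sub, innerₛₗ_apply_apply, inner_sub_right, inner_add_right,
      inner_smul_right, hf, hef] at h1
    rw [show inner ℝ f m - u * 1 - (inner ℝ f m + p * 0) = -u by ring,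
      show inner ℝ f m + q * 0 - (inner ℝ f m + s * 0 + t * 1) = -t by ring] at h1
    have h2 : SameRay ℝ u t := sameRay_neg_iff.1 h1
    rcases h2 with h2 | h2 | ⟨r, r', hr, hr', h2⟩
    · exact absurd h2 h.pos.ne'
    · exact h2.ge
    · rw [smul_eq_mul, smul_eq_mul] at h2
      by_contra! ht
      nlinarith [mul_pos hr h.pos]
  · intro ht
    refine ⟨m, (h.mem_beamLine _).2 ⟨0, by module⟩, m + s • e, (h.mem_beamLine _).2 ⟨s, rfl⟩, ?_⟩
    rw [h.center_eq, vsub_eq_sub, vsub_eq_sub,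
      show m - u • f - m = u • (-f) by module,
      show m + s • e - (m + s • e + t • f) = t • (-f) by module]
    exact (SameRay.sameRay_nonneg_smul_left _ h.pos.le).nonneg_smul_right ht

/-- The points of the arc in coordinates. -/
theorem mem_arc (h : S.HasCoords m e f u) (x : E3) :
    x ∈ S.arc ↔ ∃ s t : ℝ, x = m + s • e + t • f ∧ 0 ≤ t ∧
      √(s ^ 2 + (t + u) ^ 2) + t = √(1 + u ^ 2) := by
  have key : ∀ s t : ℝ, dist (m + s • e + t • f) S.center = √(s ^ 2 + (t + u) ^ 2) := by
    intro s t
    have := h.dist_eq m s t 0 (-u)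
    rw [h.center_eq, sub_eq_add_neg, ← neg_smul]
    rwa [zero_smul, add_zero, sub_zero, sub_neg_eq_add] at this
  constructor
  · rintro ⟨h1, h2, h3⟩
    obtain ⟨s, t, rfl⟩ := (h.mem_plane _).1 h1
    rw [h.wOppSide_iff] at h2
    rw [h.peaRadius_eq, key, abs_of_nonneg h2, h.radius_eq] at h3
    exact ⟨s, t, rfl, h2, h3⟩
  · rintro ⟨s, t, rfl, h2, h3⟩
    refine ⟨(h.mem_plane _).2 ⟨s, t, rfl⟩, (h.wOppSide_iff s t).2 h2, ?_⟩
    rw [h.peaRadius_eq, key, abs_of_nonneg h2, h.radius_eq, h3]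

/-- On the axis the tangency condition is 2t + u = √(1 + u²); squaring cancels u². This quadratic
relation is all that the uniqueness proof uses of the arc. -/
theorem of_mem_arc_axis (h : S.HasCoords m e f u) {t : ℝ} (ht : m + t • f ∈ S.arc) :
    0 ≤ t ∧ 4 * t * (t + u) = 1 := by
  obtain ⟨s, t', h1, h2, h3⟩ := (h.mem_arc _).1 ht
  obtain ⟨rfl, rfl⟩ := h.coord_eq (s := 0) (t := t) (s' := s) (t' := t')
    (by rw [add_assoc, add_right_inj] at h1; rw [← h1]; module)
  refine ⟨h2, ?_⟩
  rw [zero_pow two_ne_zero, zero_add, Real.sqrt_sq (by linarith [h.pos])] at h3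
  have := Real.sq_sqrt (show 0 ≤ 1 + u ^ 2 by positivity)
  rw [← h3] at this
  linarith

theorem mem_arc_axis (h : S.HasCoords m e f u) {t : ℝ} (ht : 0 ≤ t)
    (h2 : 4 * t * (t + u) = 1) : m + t • f ∈ S.arc := by
  refine (h.mem_arc _).2 ⟨0, t, by module, ht, ?_⟩
  have := h.pos
  rw [zero_pow two_ne_zero, zero_add, Real.sqrt_sq (by linarith), eq_comm,
    Real.sqrt_eq_iff_mul_self_eq (by positivity) (by linarith)]
  linarith

theorem mem_directrix (h : S.HasCoords m e f u) (x : E3) :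
    x ∈ S.directrix ↔ ∃ s : ℝ, x = m + s • e + √(1 + u ^ 2) • f := by
  have hd : dist m S.center = u := by
    rw [h.center_eq, dist_self_sub_right, norm_smul, h.norm_right, mul_one, Real.norm_eq_abs,
      abs_of_pos h.pos]
  have h1 : midpoint ℝ a b + (S.radius / dist (midpoint ℝ a b) S.center) •
      (midpoint ℝ a b - S.center) = m + √(1 + u ^ 2) • f := by
    rw [h.midpoint_eq, hd, h.radius_eq, h.center_eq, sub_sub_cancel, smul_smul,
      div_mul_cancel₀ _ h.pos.ne']
  have h2 : S.beamLine.direction = Submodule.span ℝ {e} := by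
    rw [beamLine, direction_affineSpan, vectorSpan_pair_rev, h.left, h.right, vsub_eq_sub,
      show m - e - (m + e) = (-2 : ℝ) • e by module]
    exact Submodule.span_singleton_smul_eq (IsUnit.mk0 _ (by norm_num)) e
  rw [directrix, h1, h2, AffineSubspace.mem_mk', Submodule.mem_span_singleton, vsub_eq_sub]
  constructor
  · rintro ⟨s, hs⟩
    exact ⟨s, by rw [hs]; abel⟩
  · rintro ⟨s, rfl⟩
    exact ⟨s, by abel⟩

/-- The equation makes the principal radius equal to 2t + u, so the distances to the focus and to
the directrix are both t + u. -/
theorem mem_peaString_axis (h : S.HasCoords m e f u) {t : ℝ} (ht : 0 ≤ t)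
    (h2 : 4 * t * (t + u) = 1) : m + t • f ∈ S.peaString := by
  have hu := h.pos
  have hr : √(1 + u ^ 2) = 2 * t + u := by
    rw [Real.sqrt_eq_iff_mul_self_eq (by positivity) (by linarith)]
    linarith
  refine ⟨(h.mem_plane _).2 ⟨0, t, by module⟩, ?_⟩
  have := h.infDist_eq m 0 t (√(1 + u ^ 2)) (D := (S.directrix : Set E3)) fun x => by
    simp only [SetLike.mem_coe, h.mem_directrix]
  rw [zero_smul, add_zero] at this
  rw [this, h.center_eq, dist_eq_norm, show m + t • f - (m - u • f) = (t + u) • f by module,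
    norm_smul, h.norm_right, mul_one, Real.norm_eq_abs, abs_of_nonneg (by linarith), hr,
    abs_of_nonpos (by linarith)]
  ring

end ParabolicPeaPod.HasCoords

end Peabody

end

noncomputable section

namespace Peabody

/-! ### Coordinates for a regular tetrahedron -/

/-- Half the distance between opposite edges of a regular tetrahedron with sides of length `2`. -/
def halfHeight : ℝ := √2 / 2

theorem halfHeight_sq : halfHeight ^ 2 = 1 / 2 := by
  rw [halfHeight, div_pow, Real.sq_sqrt (by norm_num)]
  norm_num

theorem halfHeight_pos : 0 < halfHeight := by
  rw [halfHeight]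
  positivity

theorem halfHeight_lt_one : halfHeight < 1 := by
  nlinarith [halfHeight_sq, halfHeight_pos]

/-- Orthonormal coordinates with origin `o` in which the tetrahedron has the vertices
`(±1, 0, h)` and `(0, ±1, -h)`. -/
structure TetraCoords (a b c d o e₁ e₂ e₃ : E3) : Prop where
  pair₁₂ : IsOrthoPair e₁ e₂
  pair₁₃ : IsOrthoPair e₁ e₃
  pair₂₃ : IsOrthoPair e₂ e₃
  a_eq : a = o + halfHeight • e₃ + e₁
  b_eq : b = o + halfHeight • e₃ - e₁
  c_eq : c = o - halfHeight • e₃ + e₂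
  d_eq : d = o - halfHeight • e₃ - e₂

theorem IsRegularTetrahedron.exists_tetraCoords {a b c d : E3}
    (h : IsRegularTetrahedron a b c d) : ∃ o e₁ e₂ e₃, TetraCoords a b c d o e₁ e₂ e₃ := by
  have key : ∀ x y : E3, ‖x‖ = 2 → ‖y‖ = 2 → ‖x - y‖ = 2 → inner ℝ x y = (2 : ℝ) := by
    intro x y hx hy hxy
    have := norm_sub_sq_real x y
    rw [hx, hy, hxy] at this
    linarith
  obtain ⟨p, rfl⟩ : ∃ p, b = a + p := ⟨b - a, by abel⟩
  obtain ⟨q, rfl⟩ : ∃ q, c = a + q := ⟨c - a, by abel⟩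
  obtain ⟨r, rfl⟩ : ∃ r, d = a + r := ⟨d - a, by abel⟩
  obtain ⟨hp, hq, hr, hpq, hpr, hqr⟩ := h
  rw [dist_self_add_right] at hp hq hr
  rw [dist_add_left, dist_eq_norm] at hpq hpr hqr
  have ipq := key p q hp hq hpq
  have ipr := key p r hp hr hpr
  have iqr := key q r hq hr hqr
  have iqp : inner ℝ q p = (2 : ℝ) := by rw [real_inner_comm, ipq]
  have irp : inner ℝ r p = (2 : ℝ) := by rw [real_inner_comm, ipr]
  have irq : inner ℝ r q = (2 : ℝ) := by rw [real_inner_comm, iqr]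
  have ipp : inner ℝ p p = (4 : ℝ) := by rw [real_inner_self_eq_norm_sq, hp]; norm_num
  have iqq : inner ℝ q q = (4 : ℝ) := by rw [real_inner_self_eq_norm_sq, hq]; norm_num
  have irr : inner ℝ r r = (4 : ℝ) := by rw [real_inner_self_eq_norm_sq, hr]; norm_num
  have hh := halfHeight_sq
  have unit : ∀ v : E3, inner ℝ v v = (1 : ℝ) → ‖v‖ = 1 := fun v hv => by
    rw [real_inner_self_eq_norm_sq] at hv
    exact (pow_eq_one_iff_of_nonneg (norm_nonneg v) two_ne_zero).1 hv
  have n₁ : ‖(-(1 / 2 : ℝ)) • p‖ = 1 := unit _ (by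
    simp only [inner_smul_left, inner_smul_right, ipp, conj_trivial]; norm_num)
  have n₂ : ‖(1 / 2 : ℝ) • (q - r)‖ = 1 := unit _ (by
    simp only [inner_smul_left, inner_smul_right, inner_sub_left, inner_sub_right, iqq, irr, iqr,
      irq, conj_trivial]
    norm_num)
  have n₃ : ‖(halfHeight / 2) • (p - q - r)‖ = 1 := unit _ (by
    simp only [inner_smul_left, inner_smul_right, inner_sub_left, inner_sub_right, iqq, irr, iqr,
      irq, ipp, ipq, ipr, iqp, irp, conj_trivial]
    linear_combination 2 * hh)
  -- The origin is the centroid, the first two vectors are half edges, and the third is the unit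
  -- vector from the midpoint of `cd` to that of `ab`: their difference (p - q - r)/2 has length 2h
  -- = 1/h.
  refine ⟨a + (1 / 4 : ℝ) • (p + q + r), (-(1 / 2 : ℝ)) • p, (1 / 2 : ℝ) • (q - r),
    (halfHeight / 2) • (p - q - r), ⟨n₁, n₂, ?_⟩, ⟨n₁, n₃, ?_⟩, ⟨n₂, n₃, ?_⟩, ?_, ?_, ?_, ?_⟩
  · simp only [inner_smul_left, inner_smul_right, inner_sub_right, ipq, ipr, conj_trivial]
    ring
  · simp only [inner_smul_left, inner_smul_right, inner_sub_right, ipp, ipq, ipr, conj_trivial]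
    ring
  · simp only [inner_smul_left, inner_smul_right, inner_sub_left, inner_sub_right, iqq, irr, iqr,
      irq, iqp, irp, conj_trivial]
    ring
  all_goals
    rw [smul_smul, show halfHeight * (halfHeight / 2) = 1 / 4 by linear_combination hh / 2]
    module

namespace TetraCoords

variable {a b c d o e₁ e₂ e₃ : E3}

/-- Reversing the third axis puts `cd` at height h, so that every statement about pods on `ab`
applies to pods on `cd`. -/
theorem symm (h : TetraCoords a b c d o e₁ e₂ e₃) : TetraCoords c d a b o e₂ e₁ (-e₃) where
  pair₁₂ := ⟨h.pair₁₂.norm_right, h.pair₁₂.norm_left,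
    by rw [real_inner_comm, h.pair₁₂.inner_eq]⟩
  pair₁₃ := h.pair₂₃.neg_right
  pair₂₃ := h.pair₁₃.neg_right
  a_eq := by rw [h.c_eq]; module
  b_eq := by rw [h.d_eq]; module
  c_eq := by rw [h.a_eq]; module
  d_eq := by rw [h.b_eq]; module

theorem norm_sq (h : TetraCoords a b c d o e₁ e₂ e₃) (x y z : ℝ) :
    ‖x • e₁ + y • e₂ + z • e₃‖ ^ 2 = x ^ 2 + y ^ 2 + z ^ 2 := by
  rw [norm_add_sq_real, h.pair₁₂.norm_sq, inner_add_left, inner_smul_left, inner_smul_left,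
    inner_smul_right, inner_smul_right, h.pair₁₃.inner_eq, h.pair₂₃.inner_eq, norm_smul,
    h.pair₁₃.norm_right, mul_one, Real.norm_eq_abs, sq_abs]
  ring

/-- Parseval's identity: three orthonormal vectors span the space by dimension. -/
theorem inner_eq (h : TetraCoords a b c d o e₁ e₂ e₃) (v w : E3) :
    inner ℝ v w = inner ℝ v e₁ * inner ℝ e₁ w + inner ℝ v e₂ * inner ℝ e₂ w +
      inner ℝ v e₃ * inner ℝ e₃ w := by
  have hon : Orthonormal ℝ ![e₁, e₂, e₃] := by
    constructor
    · intro i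
      fin_cases i
      · exact h.pair₁₂.norm_left
      · exact h.pair₁₂.norm_right
      · exact h.pair₁₃.norm_right
    · intro i j hij
      fin_cases i <;> fin_cases j <;>
        first
        | exact absurd rfl hij
        | exact h.pair₁₂.inner_eq
        | exact h.pair₁₃.inner_eq
        | exact h.pair₂₃.inner_eq
        | exact (real_inner_comm _ _).trans h.pair₁₂.inner_eq
        | exact (real_inner_comm _ _).trans h.pair₁₃.inner_eq
        | exact (real_inner_comm _ _).trans h.pair₂₃.inner_eq
  have hspan : Submodule.span ℝ (Set.range ![e₁, e₂, e₃]) = ⊤ :=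
    hon.linearIndependent.span_eq_top_of_card_eq_finrank' (by simp)
  have := (OrthonormalBasis.mk hon hspan.ge).sum_inner_mul_inner v w
  rw [Fin.sum_univ_three] at this
  simpa using this.symm

theorem midpoint_ab (h : TetraCoords a b c d o e₁ e₂ e₃) :
    midpoint ℝ a b = o + halfHeight • e₃ := by
  rw [h.a_eq, h.b_eq, midpoint_add_sub]

theorem midpoint_cd (h : TetraCoords a b c d o e₁ e₂ e₃) :
    midpoint ℝ c d = o - halfHeight • e₃ := by
  rw [h.c_eq, h.d_eq, midpoint_add_sub]

theorem hasCoords_of_lt (h : TetraCoords a b c d o e₁ e₂ e₃) {S : ParabolicPeaPod a b} {s : ℝ}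
    (hS : S.center = o + s • e₃) (hs : s < halfHeight) :
    S.HasCoords (o + halfHeight • e₃) e₁ e₃ (halfHeight - s) where
  toIsOrthoPair := h.pair₁₃
  left := h.a_eq
  right := h.b_eq
  center_eq := by rw [hS]; module
  pos := sub_pos.2 hs

theorem hasCoords_of_gt (h : TetraCoords a b c d o e₁ e₂ e₃) {S : ParabolicPeaPod a b} {s : ℝ}
    (hS : S.center = o + s • e₃) (hs : halfHeight < s) :
    S.HasCoords (o + halfHeight • e₃) e₁ (-e₃) (s - halfHeight) where
  toIsOrthoPair := h.pair₁₃.neg_right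
  left := h.a_eq
  right := h.b_eq
  center_eq := by rw [hS]; module
  pos := sub_pos.2 hs

/-! ### Location of the centers of a convex confocal pair -/

/-- The coordinate of the center on the common axis of the pods of a convex confocal pair. -/
theorem exists_center_eq (h : TetraCoords a b c d o e₁ e₂ e₃) {S : ParabolicPeaPod a b}
    {T : ParabolicPeaPod c d} (hST : S.axis = T.axis) :
    ∃ s : ℝ, S.center = o + s • e₃ ∧ s ≠ halfHeight := by
  have hm : midpoint ℝ c d ∈ S.axis := by
    rw [hST]
    exact right_mem_affineSpan_pair _ _ _
  rw [ParabolicPeaPod.axis, mem_affineSpan_pair_iff_exists_lineMap_eq] at hm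
  obtain ⟨r, hr⟩ := hm
  rw [h.midpoint_ab, h.midpoint_cd, AffineMap.lineMap_apply, vsub_eq_sub, vadd_eq_add] at hr
  have hr' : (1 - r) • (S.center - (o + halfHeight • e₃)) = (-2 * halfHeight) • e₃ := by
    rw [show (1 - r) • (S.center - (o + halfHeight • e₃)) =
      r • (o + halfHeight • e₃ - S.center) + S.center - (o + halfHeight • e₃) by module, hr]
    module
  have hne : 1 - r ≠ 0 := by
    intro h0
    rw [h0, zero_smul, eq_comm, smul_eq_zero] at hr'
    rcases hr' with h1 | h1
    · linarith [halfHeight_pos]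
    · have := h.pair₁₃.norm_right
      rw [h1, norm_zero] at this
      exact zero_ne_one this
  have hc : S.center = o + (halfHeight + (1 - r)⁻¹ * (-2 * halfHeight)) • e₃ := by
    have : S.center - (o + halfHeight • e₃) = ((1 - r)⁻¹ * (-2 * halfHeight)) • e₃ := by
      rw [mul_smul, ← hr', inv_smul_smul₀ hne]
    rw [sub_eq_iff_eq_add] at this
    rw [this]
    module
  refine ⟨_, hc, fun h0 => S.center_ne ?_⟩
  rw [hc, h0, h.midpoint_ab]

/-- The center may a priori lie on either side of the beam, and the bulb lies on the other side; the
two cases use opposite orientations of the axis. -/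
theorem bulb_eq (h : TetraCoords a b c d o e₁ e₂ e₃) {S : ParabolicPeaPod a b} {s t : ℝ}
    (hS : S.center = o + s • e₃) (ht : o + t • e₃ ∈ S.arc) :
    (s < halfHeight → halfHeight ≤ t ∧ 4 * (t - halfHeight) * (t - s) = 1) ∧
    (halfHeight < s → t ≤ halfHeight ∧ 4 * (halfHeight - t) * (s - t) = 1) := by
  constructor
  · intro hlt
    have := (h.hasCoords_of_lt hS hlt).of_mem_arc_axis (t := t - halfHeight) (by
      convert ht using 1; module)
    exact ⟨by linarith, by linear_combination this.2⟩
  · intro hlt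
    have := (h.hasCoords_of_gt hS hlt).of_mem_arc_axis (t := halfHeight - t) (by
      convert ht using 1; module)
    exact ⟨by linarith, by linear_combination this.2⟩

end TetraCoords

theorem IsConvexConfocal.symm {a b c d : E3} {S : ParabolicPeaPod a b} {T : ParabolicPeaPod c d}
    (h : IsConvexConfocal S T) : IsConvexConfocal T S where
  axis_eq := h.axis_eq.symm
  planes_orthogonal := h.planes_orthogonal.symm
  left_focus_mem := h.right_focus_mem
  right_focus_mem := h.left_focus_mem
  left_center_bulb := h.right_center_bulb
  right_center_bulb := h.left_center_bulb

/-- The distance of the centers of a convex confocal pair from the center of the tetrahedron. -/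
def centerDist : ℝ := (halfHeight + 1) / 2

/-- The centers of a convex confocal pair on opposite edges of a regular tetrahedron. -/
theorem TetraCoords.center_eq {a b c d o e₁ e₂ e₃ : E3} (h : TetraCoords a b c d o e₁ e₂ e₃)
    {S : ParabolicPeaPod a b} {T : ParabolicPeaPod c d} (hST : IsConvexConfocal S T) :
    S.center = o - centerDist • e₃ ∧ T.center = o + centerDist • e₃ := by
  obtain ⟨s, hs, hs'⟩ := h.exists_center_eq hST.axis_eq
  obtain ⟨t, ht, ht'⟩ := h.symm.exists_center_eq hST.axis_eq.symm
  have ht2 : T.center = o + (-t) • e₃ := by rw [ht]; module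
  have hs2 : S.center = o + (-s) • -e₃ := by rw [hs]; module
  have hS := h.bulb_eq hs (ht2 ▸ hST.right_center_bulb.1)
  have hT := h.symm.bulb_eq ht (hs2 ▸ hST.left_center_bulb.1)
  have h0 := halfHeight_pos
  have h2 := halfHeight_sq
  have hs_lt : s < halfHeight := by
    by_contra! hge
    have hgt := lt_of_le_of_ne hge hs'.symm
    obtain ⟨h3, h4⟩ := hS.2 hgt
    rcases lt_or_gt_of_ne ht' with h5 | h5
    · linarith [(hT.1 h5).1]
    -- With s, t > h the bulb equation fails: 4(h + t)(s + t) > 16h² = 8.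
    · nlinarith [mul_pos (sub_pos.2 hgt) h0, mul_pos (sub_pos.2 h5) h0]
  have ht_lt : t < halfHeight := by
    by_contra! hge
    linarith [(hS.1 hs_lt).1]
  obtain ⟨h3, h4⟩ := hS.1 hs_lt
  obtain ⟨h5, h6⟩ := hT.1 ht_lt
  have hst : s = t := by
    -- Difference of the two bulb equations. The factor s + t is negative because s, t ≤ -h.
    have : (s - t) * (s + t) = 0 := by nlinarith
    rcases mul_eq_zero.1 this with h7 | h7 <;> linarith
  subst hst
  have hs3 : s = -centerDist := by
    -- With s = t the bulb equation is 8s(s + h) = 1, whose roots are (-h ± 1)/2; the positive one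
    -- violates s ≤ -h.
    have : (s + (halfHeight + 1) / 2) * (s + (halfHeight - 1) / 2) = 0 := by nlinarith
    rw [centerDist]
    rcases mul_eq_zero.1 this with h7 | h7
    · linarith
    · linarith
  subst hs3
  exact ⟨by rw [hs]; module, by rw [ht2]; module⟩

end Peabody

end

noncomputable section

namespace Peabody

variable {a b c d o e₁ e₂ e₃ : E3}

/-! ### The convex confocal pair -/

theorem halfHeight_add_centerDist_pos : 0 < halfHeight + centerDist := by
  rw [centerDist]
  linarith [halfHeight_pos]

theorem neg_centerDist_lt : -centerDist < halfHeight := by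
  linarith [halfHeight_add_centerDist_pos]

theorem TetraCoords.hasCoords (h : TetraCoords a b c d o e₁ e₂ e₃) {S : ParabolicPeaPod a b}
    (hS : S.center = o - centerDist • e₃) :
    S.HasCoords (o + halfHeight • e₃) e₁ e₃ (halfHeight + centerDist) := by
  have := h.hasCoords_of_lt (S := S) (s := -centerDist) (by rw [hS]; module) neg_centerDist_lt
  rwa [sub_neg_eq_add] at this

theorem TetraCoords.exists_pod (h : TetraCoords a b c d o e₁ e₂ e₃) :
    ∃ S : ParabolicPeaPod a b, S.center = o - centerDist • e₃ := by
  have hc : ∀ s : ℝ, dist (o - centerDist • e₃) (o + halfHeight • e₃ + s • e₁) =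
      √(s ^ 2 + (halfHeight + centerDist) ^ 2) := by
    intro s
    have := h.pair₁₃.dist_eq o 0 (-centerDist) s halfHeight
    convert this using 2
    · module
    · module
    · ring
  refine ⟨⟨o - centerDist • e₃, ?_, ?_, ?_⟩, rfl⟩
  · intro hab
    have h1 : (2 : ℝ) • e₁ = 0 := by
      rw [show (2 : ℝ) • e₁ = (o + halfHeight • e₃ + e₁) - (o + halfHeight • e₃ - e₁) by module,
        ← h.a_eq, ← h.b_eq, hab, sub_self]
    have h2 := h.pair₁₂.norm_left
    rw [(smul_eq_zero.1 h1).resolve_left two_ne_zero, norm_zero] at h2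
    exact zero_ne_one h2
  · have h1 := hc 1
    have h2 := hc (-1)
    rw [one_smul, ← h.a_eq] at h1
    rw [neg_smul, one_smul, ← sub_eq_add_neg, ← h.b_eq, neg_sq] at h2
    rw [h1, h2]
  · intro h1
    have h2 := hc 0
    rw [h.midpoint_ab] at h1
    rw [zero_smul, add_zero, h1, dist_self, zero_pow two_ne_zero, zero_add,
      Real.sqrt_sq halfHeight_add_centerDist_pos.le] at h2
    linarith [halfHeight_add_centerDist_pos]

theorem TetraCoords.axis_eq (h : TetraCoords a b c d o e₁ e₂ e₃) {S : ParabolicPeaPod a b}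
    {T : ParabolicPeaPod c d} (hS : S.center = o - centerDist • e₃)
    (hT : T.center = o + centerDist • e₃) : S.axis = T.axis := by
  have hS' := h.hasCoords hS
  have hT' := h.symm.hasCoords (S := T) (by rw [hT]; module)
  ext x
  rw [hS'.mem_axis, hT'.mem_axis]
  constructor
  · rintro ⟨t, rfl⟩
    -- The two parametrizations start at midpoints 2h apart and run in opposite directions.
    exact ⟨-t - 2 * halfHeight, by module⟩
  · rintro ⟨t, rfl⟩
    exact ⟨-t - 2 * halfHeight, by module⟩

theorem bulb_equation : 4 * (centerDist - halfHeight) *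
    (centerDist - halfHeight + (halfHeight + centerDist)) = 1 := by
  rw [centerDist]
  linear_combination -2 * halfHeight_sq

theorem halfHeight_le_centerDist : 0 ≤ centerDist - halfHeight := by
  rw [centerDist]
  linarith [halfHeight_lt_one]

theorem TetraCoords.right_center (h : TetraCoords a b c d o e₁ e₂ e₃) {S : ParabolicPeaPod a b}
    {T : ParabolicPeaPod c d} (hS : S.center = o - centerDist • e₃)
    (hT : T.center = o + centerDist • e₃) : T.center ∈ S.peaString ∧ S.IsBulbCenter T.center := by
  have hS' := h.hasCoords hS
  have e : T.center = o + halfHeight • e₃ + (centerDist - halfHeight) • e₃ := by rw [hT]; module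
  rw [e]
  exact ⟨hS'.mem_peaString_axis halfHeight_le_centerDist bulb_equation,
    hS'.mem_arc_axis halfHeight_le_centerDist bulb_equation, (hS'.mem_axis _).2 ⟨_, rfl⟩⟩

theorem TetraCoords.isConvexConfocal (h : TetraCoords a b c d o e₁ e₂ e₃)
    {S : ParabolicPeaPod a b} {T : ParabolicPeaPod c d} (hS : S.center = o - centerDist • e₃)
    (hT : T.center = o + centerDist • e₃) : IsConvexConfocal S T := by
  have hl := h.symm.right_center (S := T) (T := S) (by rw [hT]; module) (by rw [hS]; module)
  have hr := h.right_center hS hT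
  have hS' := h.hasCoords hS
  have hT' := h.symm.hasCoords (S := T) (by rw [hT]; module)
  refine { axis_eq := h.axis_eq hS hT, planes_orthogonal := ?_, left_focus_mem := hl.1,
           right_focus_mem := hr.1, left_center_bulb := hl.2, right_center_bulb := hr.2 }
  rw [Submodule.isOrtho_iff_inner_eq]
  intro v hv w hw
  rw [h.inner_eq, Submodule.inner_left_of_mem_orthogonal hS'.dir_mem.1 hv,
    Submodule.inner_left_of_mem_orthogonal hS'.dir_mem.2 hv,
    Submodule.inner_right_of_mem_orthogonal hT'.dir_mem.1 hw]
  ring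

theorem IsRegularTetrahedron.existsUnique_isConvexConfocal (h : IsRegularTetrahedron a b c d) :
    ∃! S : ParabolicPeaPod a b × ParabolicPeaPod c d, IsConvexConfocal S.1 S.2 := by
  obtain ⟨o, e₁, e₂, e₃, hc⟩ := h.exists_tetraCoords
  obtain ⟨S, hS⟩ := hc.exists_pod
  obtain ⟨T, hT⟩ := hc.symm.exists_pod
  have hT' : T.center = o + centerDist • e₃ := by rw [hT]; module
  refine ⟨(S, T), hc.isConvexConfocal hS hT', ?_⟩
  rintro ⟨S', T'⟩ h'
  obtain ⟨h1, h2⟩ := hc.center_eq h'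
  exact Prod.ext (ParabolicPeaPod.ext (h1.trans hS.symm)) (ParabolicPeaPod.ext (h2.trans hT'.symm))

/-! ### The wedge-pod surfaces lie in the circumscribed ball -/

/-- The center is at distance (3h + 1)/2 from the beam and, as h² = 1/2, the principal radius is (h
+ 3)/2. Squaring the tangency condition then makes s² affine in the pea radius r, and s² ≥ 0 forces
r < 1. -/
theorem TetraCoords.exists_of_mem_arc (h : TetraCoords a b c d o e₁ e₂ e₃)
    {S : ParabolicPeaPod a b} (hS : S.center = o - centerDist • e₃) {x : E3} (hx : x ∈ S.arc) :
    ∃ s r : ℝ, x = o + s • e₁ + (halfHeight + r) • e₃ ∧ S.peaRadius x = r ∧ 0 ≤ r ∧ r < 1 ∧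
      s ^ 2 = 1 - 4 * (halfHeight + 1) * r := by
  have hS' := h.hasCoords hS
  have h0 := halfHeight_pos
  obtain ⟨s, r, rfl, hr, heq⟩ := (hS'.mem_arc x).1 hx
  have hrad : √(1 + (halfHeight + centerDist) ^ 2) = (halfHeight + 3) / 2 := by
    rw [Real.sqrt_eq_iff_mul_self_eq (by positivity) (by linarith), centerDist]
    linear_combination 2 * halfHeight_sq
  rw [hrad, ← eq_sub_iff_add_eq] at heq
  have hsq := Real.sq_sqrt (show 0 ≤ s ^ 2 + (r + (halfHeight + centerDist)) ^ 2 by positivity)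
  rw [heq, centerDist] at hsq
  have hs : s ^ 2 = 1 - 4 * (halfHeight + 1) * r := by
    linear_combination -hsq - 2 * halfHeight_sq
  refine ⟨s, r, by module, by rw [hS'.peaRadius_eq, abs_of_nonneg hr], hr, ?_, hs⟩
  nlinarith [sq_nonneg s]

/-- For peas of radii α and β in the two pods the centers are 2 - α - β apart. With t = α/(2 - α -
β) the squared distance of the outer point from `o` is 3/2 - 4(h + 1)t(1 - β). As β < 1, it equals
3/2 only for α = 0, when `x` is an end of the beam. -/
theorem TetraCoords.dist_outer (h : TetraCoords a b c d o e₁ e₂ e₃)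
    {S : ParabolicPeaPod a b} {T : ParabolicPeaPod c d} (hS : S.center = o - centerDist • e₃)
    (hT : T.center = o + centerDist • e₃) {x y : E3} (hx : x ∈ S.arc) (hy : y ∈ T.arc) :
    dist (S.outer x y) o < √(3 / 2) ∨ S.outer x y = a ∨ S.outer x y = b := by
  have h0 := halfHeight_pos
  have hh := halfHeight_sq
  obtain ⟨s, α, hxe, hrx, hα, hα1, hs⟩ := h.exists_of_mem_arc hS hx
  obtain ⟨s', β, hye, -, hβ, hβ1, hs'⟩ :=
    h.symm.exists_of_mem_arc (S := T) (by rw [hT]; module) hy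
  have hD : dist x y = 2 - α - β := by
    have h1 := h.norm_sq s (-s') (2 * halfHeight + α + β)
    rw [show s • e₁ + (-s') • e₂ + (2 * halfHeight + α + β) • e₃ = x - y by
      rw [hxe, hye]; module, ← dist_eq_norm] at h1
    have h2 : dist x y ^ 2 = (2 - α - β) ^ 2 := by
      rw [h1]
      linear_combination hs + hs' + 4 * hh
    exact (sq_eq_sq₀ dist_nonneg (by linarith)).1 h2
  have hDpos : 0 < 2 - α - β := by linarith
  obtain ⟨t, ht⟩ : ∃ t, t = α / (2 - α - β) := ⟨_, rfl⟩
  have htD : t * (2 - α - β) = α := by rw [ht, div_mul_cancel₀ _ hDpos.ne']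
  have hout : S.outer x y - o = (s * (1 + t)) • e₁ + (-(t * s')) • e₂ +
      ((halfHeight + α) * (1 + t) + t * (halfHeight + β)) • e₃ := by
    rw [ParabolicPeaPod.outer, hrx, hD, ← ht, hxe, hye]
    module
  rcases hα.eq_or_lt with rfl | hα
  · right
    have hx' : S.outer x y = o + s • e₁ + halfHeight • e₃ := by
      rw [zero_div] at ht
      rw [add_assoc, ← sub_eq_iff_eq_add', hout, ht]
      module
    have : (s - 1) * (s + 1) = 0 := by linear_combination hs
    rcases mul_eq_zero.1 this with h1 | h1
    · left
      rw [hx', h.a_eq, sub_eq_zero.1 h1]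
      module
    · right
      rw [hx', h.b_eq, eq_neg_of_add_eq_zero_left h1]
      module
  · left
    have htpos : 0 < t := by rw [ht]; positivity
    have hsq : ‖S.outer x y - o‖ ^ 2 = 3 / 2 - 4 * (halfHeight + 1) * t * (1 - β) := by
      rw [hout, h.norm_sq]
      linear_combination (1 + t) ^ 2 * hs + t ^ 2 * hs' + (1 + 2 * t) ^ 2 * hh +
        (t * (2 - α - β) + α + (2 * halfHeight + 4) - 2 * α) * htD
    rw [dist_eq_norm]
    refine Real.lt_sqrt_of_sq_lt ?_
    rw [hsq, sub_lt_self_iff]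
    have : 0 < 1 - β := by linarith
    positivity

/-! ### The Reuleaux tetrahedron lies in the circumscribed ball -/

theorem TetraCoords.exists_coords (h : TetraCoords a b c d o e₁ e₂ e₃) (x : E3) :
    ∃ p q r : ℝ, x = o + (p • e₁ + q • e₂ + r • e₃) := by
  refine ⟨inner ℝ e₁ (x - o), inner ℝ e₂ (x - o), inner ℝ e₃ (x - o), ?_⟩
  rw [← sub_eq_iff_eq_add']
  refine ext_inner_left ℝ fun w => ?_
  rw [h.inner_eq w (x - o), inner_add_right, inner_add_right, inner_smul_right, inner_smul_right,
    inner_smul_right]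
  ring

/-- With m = 5/4 - |x - o|²/2 and w = hr, the four balls say |p| ≤ m + w and |q| ≤ m - w. Hence w² ≤
m² and |x - o|² ≤ 2m² + 4w² ≤ 6m², that is (m - 1/2)(6m + 5) ≥ 0. So m ≥ 1/2, which is |x - o|² ≤
3/2, and equality forces w = ±1/2 and a vertex. -/
theorem TetraCoords.dist_of_mem_reuleaux (h : TetraCoords a b c d o e₁ e₂ e₃) {x : E3}
    (hx : x ∈ reuleaux a b c d) : dist x o < √(3 / 2) ∨ x = a ∨ x = b ∨ x = c ∨ x = d := by
  have h0 := halfHeight_pos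
  have hh := halfHeight_sq
  obtain ⟨p, q, r, rfl⟩ := h.exists_coords x
  obtain ⟨⟨⟨ha, hb⟩, hc⟩, hd⟩ := hx
  have key : ∀ (v : E3) (s t u : ℝ), v = o + (s • e₁ + t • e₂ + u • e₃) →
      o + (p • e₁ + q • e₂ + r • e₃) ∈ Metric.closedBall v 2 →
      (p - s) ^ 2 + (q - t) ^ 2 + (r - u) ^ 2 ≤ 4 := by
    rintro v s t u rfl hv
    rw [← h.norm_sq, show (p - s) • e₁ + (q - t) • e₂ + (r - u) • e₃ =
      o + (p • e₁ + q • e₂ + r • e₃) - (o + (s • e₁ + t • e₂ + u • e₃)) by module, ← dist_eq_norm]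
    nlinarith [Metric.mem_closedBall.1 hv, dist_nonneg (x := o + (p • e₁ + q • e₂ + r • e₃))
      (y := o + (s • e₁ + t • e₂ + u • e₃))]
  replace ha := key a 1 0 halfHeight (by rw [h.a_eq]; module) ha
  replace hb := key b (-1) 0 halfHeight (by rw [h.b_eq]; module) hb
  replace hc := key c 0 1 (-halfHeight) (by rw [h.c_eq]; module) hc
  replace hd := key d 0 (-1) (-halfHeight) (by rw [h.d_eq]; module) hd
  obtain ⟨w, hw⟩ : ∃ w, w = halfHeight * r := ⟨_, rfl⟩
  have hr : r = 2 * halfHeight * w := by rw [hw]; linear_combination -2 * r * hh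
  have hr2 : r ^ 2 = 2 * w ^ 2 := by rw [hr]; linear_combination 4 * w ^ 2 * hh
  obtain ⟨m, hm⟩ : ∃ m, m = 5 / 4 - (p ^ 2 + q ^ 2 + r ^ 2) / 2 := ⟨_, rfl⟩
  replace ha : p ≥ -(m + w) := by linarith
  replace hb : p ≤ m + w := by linarith
  replace hc : q ≥ -(m - w) := by linarith
  replace hd : q ≤ m - w := by linarith
  have hp2 : p ^ 2 ≤ (m + w) ^ 2 := sq_le_sq' ha hb
  have hq2 : q ^ 2 ≤ (m - w) ^ 2 := sq_le_sq' hc hd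
  rcases lt_or_ge (p ^ 2 + q ^ 2 + r ^ 2) (3 / 2) with hlt | hge
  · left
    rw [dist_self_add_left]
    refine Real.lt_sqrt_of_sq_lt ?_
    rwa [h.norm_sq]
  · right
    have hw2 : w ^ 2 ≤ m ^ 2 := sq_le_sq' (by linarith) (by linarith)
    have hm1 : m = 1 / 2 := by
      have hm2 : m ≤ 1 / 2 := by linarith
      have hm3 : 0 ≤ m := by linarith
      have hm4 : 0 ≤ (m - 1 / 2) * (6 * m + 5) := by linarith
      have hm5 := nonneg_of_mul_nonneg_left hm4 (by linarith)
      linarith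
    rw [hm1] at ha hb hc hd hp2 hq2 hw2 hm
    have hw3 : (w - 1 / 2) * (w + 1 / 2) = 0 := by linarith
    rcases mul_eq_zero.1 hw3 with hw4 | hw4
    · obtain rfl : w = 1 / 2 := by linarith
      obtain rfl : q = 0 := by linarith
      have hp3 : (p - 1) * (p + 1) = 0 := by nlinarith
      rcases mul_eq_zero.1 hp3 with hp4 | hp4
      · left
        rw [h.a_eq, hr, sub_eq_zero.1 hp4]
        module
      · right; left
        rw [h.b_eq, hr, eq_neg_of_add_eq_zero_left hp4]
        module
    · obtain rfl : w = -(1 / 2) := by linarith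
      obtain rfl : p = 0 := by linarith
      have hq3 : (q - 1) * (q + 1) = 0 := by nlinarith
      rcases mul_eq_zero.1 hq3 with hq4 | hq4
      · right; right; left
        rw [h.c_eq, hr, sub_eq_zero.1 hq4]
        module
      · right; right; right
        rw [h.d_eq, hr, eq_neg_of_add_eq_zero_left hq4]
        module

end Peabody

end

noncomputable section

namespace Peabody

variable {a b c d : E3}

/-! ### The ends of the beam, and exchanging them -/

namespace ParabolicPeaPod

theorem peaRadius_of_mem (S : ParabolicPeaPod a b) {x : E3} (hx : x ∈ S.beamLine) :
    S.peaRadius x = 0 :=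
  Metric.infDist_zero_of_mem hx

theorem left_mem_beamLine (S : ParabolicPeaPod a b) : a ∈ S.beamLine :=
  left_mem_affineSpan_pair ℝ a b

theorem right_mem_beamLine (S : ParabolicPeaPod a b) : b ∈ S.beamLine :=
  right_mem_affineSpan_pair ℝ a b

theorem left_mem_arc (S : ParabolicPeaPod a b) : a ∈ S.arc := by
  refine ⟨subset_affineSpan ℝ _ (by simp),
    AffineSubspace.wOppSide_of_right_mem _ S.left_mem_beamLine, ?_⟩
  rw [S.peaRadius_of_mem S.left_mem_beamLine, add_zero, dist_comm, radius]

theorem right_mem_arc (S : ParabolicPeaPod a b) : b ∈ S.arc := by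
  refine ⟨subset_affineSpan ℝ _ (by simp),
    AffineSubspace.wOppSide_of_right_mem _ S.right_mem_beamLine, ?_⟩
  rw [S.peaRadius_of_mem S.right_mem_beamLine, add_zero, dist_comm, radius, S.dist_ends]

theorem outer_of_mem (S : ParabolicPeaPod a b) {x : E3} (hx : x ∈ S.beamLine) (y : E3) :
    S.outer x y = x := by
  rw [outer, S.peaRadius_of_mem hx, zero_div, zero_smul, add_zero]

/-- The same pea pod with the ends of the beam exchanged. -/
def flip (S : ParabolicPeaPod a b) : ParabolicPeaPod b a where
  center := S.center
  ends_ne := S.ends_ne.symm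
  dist_ends := S.dist_ends.symm
  center_ne := by
    rw [midpoint_comm]
    exact S.center_ne

variable (S : ParabolicPeaPod a b)

@[simp]
theorem flip_center : S.flip.center = S.center := rfl

@[simp]
theorem flip_radius : S.flip.radius = S.radius := S.dist_ends.symm

@[simp]
theorem flip_plane : S.flip.plane = S.plane := by
  rw [plane, plane, Set.insert_comm]
  rfl

@[simp]
theorem flip_axis : S.flip.axis = S.axis := by
  rw [axis, axis, midpoint_comm]
  rfl

@[simp]
theorem flip_beamLine : S.flip.beamLine = S.beamLine := by
  rw [beamLine, beamLine, Set.pair_comm]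

@[simp]
theorem flip_peaRadius : S.flip.peaRadius = S.peaRadius := by
  ext x
  rw [peaRadius, peaRadius, flip_beamLine]

@[simp]
theorem flip_arc : S.flip.arc = S.arc := by
  simp only [arc, flip_plane, flip_beamLine, flip_center, flip_peaRadius, flip_radius]

@[simp]
theorem flip_peaString : S.flip.peaString = S.peaString := by
  simp only [peaString, directrix, flip_plane, flip_beamLine, flip_center, flip_radius,
    midpoint_comm b a]

@[simp]
theorem flip_outer : S.flip.outer = S.outer := by
  ext1 x
  ext1 y
  simp only [outer, flip_peaRadius]

@[simp]
theorem flip_edgeCurve (v : E3) : S.flip.edgeCurve v = S.edgeCurve v := by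
  simp only [edgeCurve, flip_outer, flip_arc]

end ParabolicPeaPod

theorem IsConvexConfocal.flip_left {S : ParabolicPeaPod a b} {T : ParabolicPeaPod c d}
    (h : IsConvexConfocal S T) : IsConvexConfocal S.flip T where
  axis_eq := by rw [S.flip_axis, h.axis_eq]
  planes_orthogonal := by rw [S.flip_plane]; exact h.planes_orthogonal
  left_focus_mem := h.left_focus_mem
  right_focus_mem := by rw [S.flip_peaString]; exact h.right_focus_mem
  left_center_bulb := h.left_center_bulb
  right_center_bulb := by
    rw [ParabolicPeaPod.IsBulbCenter, S.flip_arc, S.flip_axis]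
    exact h.right_center_bulb

@[simp]
theorem wedgePod_flip_left (S : ParabolicPeaPod a b) (T : ParabolicPeaPod c d) :
    wedgePod S.flip T = wedgePod S T := by
  simp only [wedgePod, S.flip_outer, S.flip_arc]

@[simp]
theorem wedgePod_flip_right (S : ParabolicPeaPod a b) (T : ParabolicPeaPod c d) :
    wedgePod S T.flip = wedgePod S T := by
  simp only [wedgePod, T.flip_arc]

/-! ### Relabelling the vertices -/

namespace IsRegularTetrahedron

theorem swap_bc (h : IsRegularTetrahedron a b c d) : IsRegularTetrahedron a c b d :=
  ⟨h.ac, h.ab, h.ad, by rw [dist_comm, h.bc], h.cd, h.bd⟩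

theorem swap_cd (h : IsRegularTetrahedron a b c d) : IsRegularTetrahedron a b d c :=
  ⟨h.ab, h.ad, h.ac, h.bd, h.bc, by rw [dist_comm, h.cd]⟩

end IsRegularTetrahedron

theorem reuleaux_swap_ab : reuleaux b a c d = reuleaux a b c d := by
  unfold reuleaux; ext x; simp only [Set.mem_inter_iff]; tauto

theorem reuleaux_swap_bc : reuleaux a c b d = reuleaux a b c d := by
  unfold reuleaux; ext x; simp only [Set.mem_inter_iff]; tauto

theorem reuleaux_swap_cd : reuleaux a b d c = reuleaux a b c d := by
  unfold reuleaux; ext x; simp only [Set.mem_inter_iff]; tauto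

namespace ParabolicDevices

variable (P : ParabolicDevices a b c d)

/-- The devices after exchanging the labels `a` and `b`. -/
def swapAB : ParabolicDevices b a c d where
  ab := P.ab.flip
  cd := P.cd
  ac := P.bc
  bd := P.ad
  ad := P.bd
  bc := P.ac
  ab_cd := P.ab_cd.flip_left
  ac_bd := P.ad_bc.symm
  ad_bc := P.ac_bd.symm

/-- The devices after exchanging the labels `b` and `c`. -/
def swapBC : ParabolicDevices a c b d where
  ab := P.ac
  cd := P.bd
  ac := P.ab
  bd := P.cd
  ad := P.ad
  bc := P.bc.flip
  ab_cd := P.ac_bd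
  ac_bd := P.ab_cd
  ad_bc := P.ad_bc.symm.flip_left.symm

/-- The devices after exchanging the labels `c` and `d`. -/
def swapCD : ParabolicDevices a b d c where
  ab := P.ab
  cd := P.cd.flip
  ac := P.ad
  bd := P.bc
  ad := P.ac
  bc := P.bd
  ab_cd := P.ab_cd.symm.flip_left.symm
  ac_bd := P.ad_bc
  ad_bc := P.ac_bd

/-- Relabelling permutes the wedge-pod surfaces, the caps and the curves bounding each cap, so only
the order of the unions changes. -/
theorem surface_swapAB : P.swapAB.surface = P.surface := by
  simp only [surface, wedges, caps, swapAB, reuleaux_swap_ab, wedgePod_flip_left,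
    wedgePod_flip_right, ParabolicPeaPod.flip_edgeCurve]
  simp only [Set.union_comm, Set.union_left_comm]

theorem surface_swapBC : P.swapBC.surface = P.surface := by
  simp only [surface, wedges, caps, swapBC, reuleaux_swap_bc, wedgePod_flip_left,
    wedgePod_flip_right, ParabolicPeaPod.flip_edgeCurve]
  simp only [Set.union_comm, Set.union_left_comm]

theorem surface_swapCD : P.swapCD.surface = P.surface := by
  simp only [surface, wedges, caps, swapCD, reuleaux_swap_cd, wedgePod_flip_left,
    wedgePod_flip_right, ParabolicPeaPod.flip_edgeCurve]
  simp only [Set.union_comm, Set.union_left_comm]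

end ParabolicDevices

/-- Robert's body does not depend on the order of the vertices. -/
theorem IsRobertsBody.perm (σ : Equiv.Perm (Fin 4)) : ∀ (v : Fin 4 → E3) {R : Set E3},
    IsRobertsBody (v 0) (v 1) (v 2) (v 3) R →
      IsRobertsBody (v (σ 0)) (v (σ 1)) (v (σ 2)) (v (σ 3)) R := by
  have hσ : σ ∈ Submonoid.closure (Set.range fun i : Fin 3 => Equiv.swap i.castSucc i.succ) := by
    rw [Equiv.Perm.mclosure_swap_castSucc_succ]
    trivial
  induction hσ using Submonoid.closure_induction with
  | mem x hx =>
    obtain ⟨i, rfl⟩ := hx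
    rintro v R ⟨P, rfl⟩
    fin_cases i
    · exact ⟨P.swapAB, congrArg (convexHull ℝ) P.surface_swapAB.symm⟩
    · exact ⟨P.swapBC, congrArg (convexHull ℝ) P.surface_swapBC.symm⟩
    · exact ⟨P.swapCD, congrArg (convexHull ℝ) P.surface_swapCD.symm⟩
  | one => exact fun v R h => h
  -- The labelling must be arbitrary in the induction: the second factor acts on the already
  -- permuted one.
  | mul x y _ _ hx hy => exact fun v R h => hy (v ∘ x) (hx v h)

/-! ### Existence and uniqueness of the body -/

theorem IsRegularTetrahedron.nonempty_devices (h : IsRegularTetrahedron a b c d) :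
    Nonempty (ParabolicDevices a b c d) := by
  obtain ⟨⟨S₁, T₁⟩, h₁, -⟩ := h.existsUnique_isConvexConfocal
  obtain ⟨⟨S₂, T₂⟩, h₂, -⟩ := h.swap_bc.existsUnique_isConvexConfocal
  obtain ⟨⟨S₃, T₃⟩, h₃, -⟩ := h.swap_cd.swap_bc.existsUnique_isConvexConfocal
  exact ⟨⟨S₁, T₁, S₂, T₂, S₃, T₃, h₁, h₂, h₃⟩⟩

theorem IsRegularTetrahedron.subsingleton_devices (h : IsRegularTetrahedron a b c d) :
    Subsingleton (ParabolicDevices a b c d) := by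
  have unique : ∀ {a b c d : E3}, IsRegularTetrahedron a b c d →
      ∀ {S S' : ParabolicPeaPod a b} {T T' : ParabolicPeaPod c d}, IsConvexConfocal S T →
        IsConvexConfocal S' T' → S = S' ∧ T = T' := by
    intro a b c d h S S' T T' h₁ h₂
    exact Prod.mk.inj (h.existsUnique_isConvexConfocal.unique (y₁ := (S, T)) (y₂ := (S', T')) h₁ h₂)
  constructor
  rintro ⟨ab, cd, ac, bd, ad, bc, h₁, h₂, h₃⟩ ⟨ab', cd', ac', bd', ad', bc', h₁', h₂', h₃'⟩
  obtain ⟨rfl, rfl⟩ := unique h h₁ h₁'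
  obtain ⟨rfl, rfl⟩ := unique h.swap_bc h₂ h₂'
  obtain ⟨rfl, rfl⟩ := unique h.swap_cd.swap_bc h₃ h₃'
  rfl

theorem IsRegularTetrahedron.existsUnique_isRobertsBody (h : IsRegularTetrahedron a b c d) :
    ∃! R : Set E3, IsRobertsBody a b c d R := by
  obtain ⟨P⟩ := h.nonempty_devices
  refine ⟨_, ⟨P, rfl⟩, ?_⟩
  rintro R ⟨Q, rfl⟩
  rw [h.subsingleton_devices.elim Q P]

end Peabody

end

noncomputable section

namespace Peabody

variable {a b c d o e₁ e₂ e₃ : E3}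

/-! ### Isometries -/

theorem IsRegularTetrahedron.map (h : IsRegularTetrahedron a b c d) (g : E3 ≃ᵃⁱ[ℝ] E3) :
    IsRegularTetrahedron (g a) (g b) (g c) (g d) := by
  constructor <;> rw [g.dist_map]
  exacts [h.ab, h.ac, h.ad, h.bc, h.bd, h.cd]

theorem IsOrthoPair.map {e f : E3} (h : IsOrthoPair e f) (L : E3 ≃ₗᵢ[ℝ] E3) :
    IsOrthoPair (L e) (L f) :=
  ⟨by rw [L.norm_map, h.norm_left], by rw [L.norm_map, h.norm_right],
    by rw [L.inner_map_map, h.inner_eq]⟩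

theorem map_add_eq (g : E3 ≃ᵃⁱ[ℝ] E3) (x v : E3) :
    g (x + v) = g x + g.linearIsometryEquiv v := by
  rw [add_comm, ← vadd_eq_add, g.map_vadd, vadd_eq_add, add_comm]

theorem map_sub_eq (g : E3 ≃ᵃⁱ[ℝ] E3) (x v : E3) :
    g (x - v) = g x - g.linearIsometryEquiv v := by
  rw [sub_eq_add_neg, map_add_eq, map_neg, sub_eq_add_neg]

theorem TetraCoords.map (h : TetraCoords a b c d o e₁ e₂ e₃) (g : E3 ≃ᵃⁱ[ℝ] E3) :
    TetraCoords (g a) (g b) (g c) (g d) (g o) (g.linearIsometryEquiv e₁)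
      (g.linearIsometryEquiv e₂) (g.linearIsometryEquiv e₃) where
  pair₁₂ := h.pair₁₂.map _
  pair₁₃ := h.pair₁₃.map _
  pair₂₃ := h.pair₂₃.map _
  a_eq := by rw [h.a_eq, map_add_eq, map_add_eq, map_smul]
  b_eq := by rw [h.b_eq, map_sub_eq, map_add_eq, map_smul]
  c_eq := by rw [h.c_eq, map_add_eq, map_sub_eq, map_smul]
  d_eq := by rw [h.d_eq, map_sub_eq, map_sub_eq, map_smul]

/-- The formula for the centers holds in any tetrahedral coordinates, and `g` transports such
coordinates to the image tetrahedron. -/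
theorem IsRegularTetrahedron.map_center (h : IsRegularTetrahedron a b c d) (g : E3 ≃ᵃⁱ[ℝ] E3)
    {S : ParabolicPeaPod a b} {T : ParabolicPeaPod c d} (hST : IsConvexConfocal S T)
    {S' : ParabolicPeaPod (g a) (g b)} {T' : ParabolicPeaPod (g c) (g d)}
    (hST' : IsConvexConfocal S' T') : S'.center = g S.center ∧ T'.center = g T.center := by
  obtain ⟨o, e₁, e₂, e₃, hc⟩ := h.exists_tetraCoords
  obtain ⟨h1, h2⟩ := hc.center_eq hST
  obtain ⟨h3, h4⟩ := (hc.map g).center_eq hST'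
  rw [h1, h2, h3, h4, map_sub_eq, map_add_eq, map_smul]
  exact ⟨rfl, rfl⟩

namespace ParabolicPeaPod

variable {g : E3 ≃ᵃⁱ[ℝ] E3} {S : ParabolicPeaPod a b} {S' : ParabolicPeaPod (g a) (g b)}

theorem beamLine_map : S'.beamLine = S.beamLine.map (g : E3 →ᵃ[ℝ] E3) := by
  rw [beamLine, beamLine, AffineSubspace.map_span, Set.image_pair]
  rfl

theorem plane_map (h : S'.center = g S.center) :
    S'.plane = S.plane.map (g : E3 →ᵃ[ℝ] E3) := by
  rw [plane, plane, AffineSubspace.map_span, Set.image_insert_eq, Set.image_pair, h]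
  rfl

theorem peaRadius_map (x : E3) : S'.peaRadius (g x) = S.peaRadius x := by
  rw [peaRadius, peaRadius, beamLine_map (S := S), AffineSubspace.coe_map]
  exact Metric.infDist_image g.isometry

theorem arc_map (h : S'.center = g S.center) : S'.arc = g '' S.arc := by
  have key : ∀ x, g x ∈ S'.arc ↔ x ∈ S.arc := by
    intro x
    have h1 : g x ∈ S'.plane ↔ x ∈ S.plane := by
      rw [plane_map h]
      exact AffineSubspace.mem_map_iff_mem_of_injective g.injective
    have h2 : S'.beamLine.WOppSide S'.center (g x) ↔ S.beamLine.WOppSide S.center x := by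
      rw [beamLine_map (S := S), h]
      exact Function.Injective.wOppSide_map_iff (f := (g : E3 →ᵃ[ℝ] E3)) g.injective
    rw [arc, arc, Set.mem_ofPred_eq, Set.mem_ofPred_eq, h1, h2, peaRadius_map (S := S), radius,
      radius, h, g.dist_map, g.dist_map]
  ext y
  obtain ⟨x, rfl⟩ := g.surjective y
  rw [key, g.injective.mem_set_image]

theorem outer_map (x y : E3) : S'.outer (g x) (g y) = g (S.outer x y) := by
  rw [outer, outer, peaRadius_map (S := S), g.dist_map, map_add_eq, map_smul]
  congr 2
  rw [← vsub_eq_sub, ← vsub_eq_sub]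
  exact (g.map_vsub x y).symm

theorem edgeCurve_map (h : S'.center = g S.center) (v : E3) :
    S'.edgeCurve (g v) = g '' S.edgeCurve v := by
  rw [edgeCurve, edgeCurve, arc_map h, Set.image_image, Set.image_image]
  exact Set.image_congr fun x _ => outer_map x v

end ParabolicPeaPod

theorem wedgePod_map {g : E3 ≃ᵃⁱ[ℝ] E3} {S : ParabolicPeaPod a b} {T : ParabolicPeaPod c d}
    {S' : ParabolicPeaPod (g a) (g b)} {T' : ParabolicPeaPod (g c) (g d)}
    (hS : S'.center = g S.center) (hT : T'.center = g T.center) :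
    wedgePod S' T' = g '' wedgePod S T := by
  rw [wedgePod, wedgePod, ParabolicPeaPod.arc_map hS, ParabolicPeaPod.arc_map hT,
    Set.image2_image_left, Set.image2_image_right, Set.image_image2]
  exact Set.image2_congr' fun x y => ParabolicPeaPod.outer_map x y

theorem image_closedBall_eq (g : E3 ≃ᵃⁱ[ℝ] E3) (x : E3) (r : ℝ) :
    g '' Metric.closedBall x r = Metric.closedBall (g x) r :=
  g.toIsometryEquiv.image_closedBall x r

theorem image_sphere_eq (g : E3 ≃ᵃⁱ[ℝ] E3) (x : E3) (r : ℝ) :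
    g '' Metric.sphere x r = Metric.sphere (g x) r :=
  g.toIsometryEquiv.image_sphere x r

theorem reuleaux_map (g : E3 ≃ᵃⁱ[ℝ] E3) :
    reuleaux (g a) (g b) (g c) (g d) = g '' reuleaux a b c d := by
  rw [reuleaux, reuleaux, Set.image_inter g.injective, Set.image_inter g.injective,
    Set.image_inter g.injective, image_closedBall_eq, image_closedBall_eq, image_closedBall_eq,
    image_closedBall_eq]

/-- A cap is built from a sphere, connected components and a frontier, all of which a surjective
isometry respects. -/
theorem cap_map (g : E3 ≃ᵃⁱ[ℝ] E3) (K : Set E3) (v : E3) (Γ : Set E3) :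
    cap (g '' K) (g v) (g '' Γ) = g '' cap K v Γ := by
  have hs : Metric.sphere (g v) 2 \ g '' Γ = g '' (Metric.sphere v 2 \ Γ) := by
    rw [Set.image_sdiff g.injective, image_sphere_eq]
  have hf : frontier (g '' K) = g '' frontier K := (g.toHomeomorph.image_frontier K).symm
  rw [cap, cap, Set.image_union, hs, hf]
  congr 1
  ext y
  obtain ⟨x, rfl⟩ := g.surjective y
  rw [g.injective.mem_set_image, Set.mem_ofPred_eq, Set.mem_ofPred_eq, g.injective.mem_set_image]
  refine and_congr_right fun hx => ?_
  have := g.toHomeomorph.image_connectedComponentIn hx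
  rw [AffineIsometryEquiv.coe_toHomeomorph] at this
  rw [← this, Set.image_subset_image_iff g.injective]

theorem ParabolicDevices.surface_map (h : IsRegularTetrahedron a b c d) (g : E3 ≃ᵃⁱ[ℝ] E3)
    (P : ParabolicDevices a b c d) (Q : ParabolicDevices (g a) (g b) (g c) (g d)) :
    Q.surface = g '' P.surface := by
  obtain ⟨h1, h2⟩ := h.map_center g P.ab_cd Q.ab_cd
  obtain ⟨h3, h4⟩ := h.swap_bc.map_center g P.ac_bd Q.ac_bd
  obtain ⟨h5, h6⟩ := h.swap_cd.swap_bc.map_center g P.ad_bc Q.ad_bc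
  have hW : Q.wedges = g '' P.wedges := by
    simp only [wedges, Set.image_union, wedgePod_map h1 h2, wedgePod_map h2 h1, wedgePod_map h3 h4,
      wedgePod_map h4 h3, wedgePod_map h5 h6, wedgePod_map h6 h5]
  have hC : Q.caps = g '' P.caps := by
    simp only [caps, ParabolicPeaPod.edgeCurve_map h1, ParabolicPeaPod.edgeCurve_map h2,
      ParabolicPeaPod.edgeCurve_map h3, ParabolicPeaPod.edgeCurve_map h4,
      ParabolicPeaPod.edgeCurve_map h5, ParabolicPeaPod.edgeCurve_map h6, reuleaux_map,
      ← Set.image_union, cap_map]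
  rw [surface, surface, Set.image_union, hW, hC]

theorem IsRobertsBody.map (h : IsRegularTetrahedron a b c d) (g : E3 ≃ᵃⁱ[ℝ] E3) {R : Set E3}
    (hR : IsRobertsBody a b c d R) : IsRobertsBody (g a) (g b) (g c) (g d) (g '' R) := by
  obtain ⟨P, rfl⟩ := hR
  obtain ⟨Q⟩ := (h.map g).nonempty_devices
  refine ⟨Q, ?_⟩
  rw [ParabolicDevices.surface_map h g P Q]
  exact (g.toAffineEquiv : E3 →ᵃ[ℝ] E3).image_convexHull _

/-! ### The body touches the circumscribed sphere at the vertices only -/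

theorem TetraCoords.origin_eq (h : TetraCoords a b c d o e₁ e₂ e₃) :
    o = (1 / 4 : ℝ) • (a + b + c + d) := by
  rw [h.a_eq, h.b_eq, h.c_eq, h.d_eq]
  module

/-- The open ball bounded by the circumscribed sphere, together with the vertices. -/
def openBallWithVertices (a b c d : E3) : Set E3 :=
  Metric.ball ((1 / 4 : ℝ) • (a + b + c + d)) √(3 / 2) ∪ {a, b, c, d}

theorem openBallWithVertices_swap_bc :
    openBallWithVertices a c b d = openBallWithVertices a b c d := by
  rw [openBallWithVertices, openBallWithVertices, Set.insert_comm c b, add_right_comm a c b]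

theorem openBallWithVertices_swap_cd :
    openBallWithVertices a b d c = openBallWithVertices a b c d := by
  rw [openBallWithVertices, openBallWithVertices, Set.pair_comm d c, add_right_comm (a + b) d c]

theorem IsRegularTetrahedron.wedgePod_subset (h : IsRegularTetrahedron a b c d)
    {S : ParabolicPeaPod a b} {T : ParabolicPeaPod c d} (hST : IsConvexConfocal S T) :
    wedgePod S T ∪ wedgePod T S ⊆ openBallWithVertices a b c d := by
  obtain ⟨o, e₁, e₂, e₃, hc⟩ := h.exists_tetraCoords
  obtain ⟨hS, hT⟩ := hc.center_eq hST
  rintro _ (⟨x, hx, y, hy, rfl⟩ | ⟨x, hx, y, hy, rfl⟩)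
  · have := hc.dist_outer hS hT hx hy
    rw [openBallWithVertices, ← hc.origin_eq]
    simp only [Set.mem_union, Metric.mem_ball, Set.mem_insert_iff, Set.mem_singleton_iff]
    tauto
  · have := hc.symm.dist_outer (S := T) (T := S) (by rw [hT]; module) (by rw [hS]; module) hx hy
    rw [openBallWithVertices, ← hc.origin_eq]
    simp only [Set.mem_union, Metric.mem_ball, Set.mem_insert_iff, Set.mem_singleton_iff]
    tauto

theorem IsRegularTetrahedron.reuleaux_subset (h : IsRegularTetrahedron a b c d) :
    reuleaux a b c d ⊆ openBallWithVertices a b c d := by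
  obtain ⟨o, e₁, e₂, e₃, hc⟩ := h.exists_tetraCoords
  intro x hx
  rw [openBallWithVertices, ← hc.origin_eq]
  exact hc.dist_of_mem_reuleaux hx

/-- Applied to an end `v` of the opposite beam, this lets the curves bounding the caps inherit the
estimate for wedge-pod surfaces. -/
theorem ParabolicPeaPod.edgeCurve_subset (S : ParabolicPeaPod a b) (T : ParabolicPeaPod c d)
    {v : E3} (hv : v ∈ T.arc) : S.edgeCurve v ⊆ wedgePod S T := by
  rintro _ ⟨x, hx, rfl⟩
  exact ⟨x, hx, v, hv, rfl⟩

theorem isClosed_reuleaux : IsClosed (reuleaux a b c d) :=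
  ((Metric.isClosed_closedBall.inter Metric.isClosed_closedBall).inter
    Metric.isClosed_closedBall).inter Metric.isClosed_closedBall

/-- A point of the cap off the curve lies in its own component, hence in the frontier of the closed
set `K`. The actual shape of the caps plays no role. -/
theorem cap_subset {K U Γ : Set E3} {v : E3} (hK : IsClosed K) (hKU : K ⊆ U) (hΓ : Γ ⊆ U) :
    cap K v Γ ⊆ U := by
  refine Set.union_subset hΓ fun p hp => hKU (hK.frontier_subset (hp.2 ?_))
  exact mem_connectedComponentIn hp.1

namespace ParabolicDevices

theorem wedges_subset (h : IsRegularTetrahedron a b c d) (P : ParabolicDevices a b c d) :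
    P.wedges ⊆ openBallWithVertices a b c d := by
  have h1 := h.wedgePod_subset P.ab_cd
  have h2 := h.swap_bc.wedgePod_subset P.ac_bd
  have h3 := h.swap_cd.swap_bc.wedgePod_subset P.ad_bc
  rw [openBallWithVertices_swap_bc] at h2
  rw [openBallWithVertices_swap_bc, openBallWithVertices_swap_cd] at h3
  have := Set.union_subset (Set.union_subset h1 h2) h3
  simpa only [wedges, Set.union_assoc] using this

theorem surface_subset (h : IsRegularTetrahedron a b c d) (P : ParabolicDevices a b c d) :
    P.surface ⊆ openBallWithVertices a b c d := by
  have hW := P.wedges_subset h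
  have hΓ : ∀ {p q r s : E3} {S : ParabolicPeaPod p q} {T : ParabolicPeaPod r s} {v : E3},
      wedgePod S T ⊆ P.wedges → v ∈ T.arc → S.edgeCurve v ⊆ openBallWithVertices a b c d :=
    fun h1 hv => ((ParabolicPeaPod.edgeCurve_subset _ _ hv).trans h1).trans hW
  have hab : wedgePod P.ab P.cd ⊆ P.wedges := by intro x hx; simp [wedges, hx]
  have hcd : wedgePod P.cd P.ab ⊆ P.wedges := by intro x hx; simp [wedges, hx]
  have hac : wedgePod P.ac P.bd ⊆ P.wedges := by intro x hx; simp [wedges, hx]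
  have hbd : wedgePod P.bd P.ac ⊆ P.wedges := by intro x hx; simp [wedges, hx]
  have had : wedgePod P.ad P.bc ⊆ P.wedges := by intro x hx; simp [wedges, hx]
  have hbc : wedgePod P.bc P.ad ⊆ P.wedges := by intro x hx; simp [wedges, hx]
  have hcap : ∀ {v : E3} {Γ : Set E3}, Γ ⊆ openBallWithVertices a b c d →
      cap (reuleaux a b c d) v Γ ⊆ openBallWithVertices a b c d :=
    fun h1 => cap_subset isClosed_reuleaux h.reuleaux_subset h1
  refine Set.union_subset hW (Set.union_subset (Set.union_subset (Set.union_subset ?_ ?_) ?_) ?_) <;>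
    refine hcap (Set.union_subset (Set.union_subset ?_ ?_) ?_)
  · exact hΓ hbc P.ad.left_mem_arc
  · exact hΓ hcd P.ab.left_mem_arc
  · exact hΓ hbd P.ac.left_mem_arc
  · exact hΓ hcd P.ab.right_mem_arc
  · exact hΓ had P.bc.left_mem_arc
  · exact hΓ hac P.bd.left_mem_arc
  · exact hΓ hab P.cd.left_mem_arc
  · exact hΓ hbd P.ac.right_mem_arc
  · exact hΓ had P.bc.right_mem_arc
  · exact hΓ hab P.cd.right_mem_arc
  · exact hΓ hbc P.ad.right_mem_arc
  · exact hΓ hac P.bd.right_mem_arc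

theorem vertices_subset_surface (P : ParabolicDevices a b c d) : {a, b, c, d} ⊆ P.surface := by
  have key : ∀ {p q r s x : E3} (S : ParabolicPeaPod p q) (T : ParabolicPeaPod r s),
      x ∈ S.arc → x ∈ S.beamLine → x ∈ wedgePod S T := fun S T h1 h2 =>
    ⟨_, h1, _, T.left_mem_arc, S.outer_of_mem h2 _⟩
  have ha := key P.ab P.cd P.ab.left_mem_arc P.ab.left_mem_beamLine
  have hb := key P.ab P.cd P.ab.right_mem_arc P.ab.right_mem_beamLine
  have hc := key P.cd P.ab P.cd.left_mem_arc P.cd.left_mem_beamLine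
  have hd := key P.cd P.ab P.cd.right_mem_arc P.cd.right_mem_beamLine
  rintro x (rfl | rfl | rfl | rfl) <;> simp [surface, wedges, *]

end ParabolicDevices

/-- If a set contains the vertices and otherwise lies inside the circumscribed sphere, then the
isometries that preserve its convex hull permute the vertices. -/
theorem IsRegularTetrahedron.image_vertices (h : IsRegularTetrahedron a b c d) {s : Set E3}
    (hs : {a, b, c, d} ⊆ s) (hs' : s ⊆ openBallWithVertices a b c d) (g : E3 ≃ᵃⁱ[ℝ] E3)
    (hg : g '' convexHull ℝ s = convexHull ℝ s) : g '' {a, b, c, d} = {a, b, c, d} := by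
  obtain ⟨o, e₁, e₂, e₃, hc⟩ := h.exists_tetraCoords
  rw [openBallWithVertices, ← hc.origin_eq] at hs'
  have hh := halfHeight_sq
  have hρ : (√(3 / 2) : ℝ) ^ 2 = 3 / 2 := Real.sq_sqrt (by norm_num)
  have key : ∀ (v : E3) (x y z p q r : ℝ), v = o + (x • e₁ + y • e₂ + z • e₃) →
      dist v (o + (p • e₁ + q • e₂ + r • e₃)) ^ 2 = (x - p) ^ 2 + (y - q) ^ 2 + (z - r) ^ 2 := by
    rintro v x y z p q r rfl
    rw [← hc.norm_sq, dist_eq_norm]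
    congr 2
    module
  have da := fun p q r => key a 1 0 halfHeight p q r (by rw [hc.a_eq]; module)
  have db := fun p q r => key b (-1) 0 halfHeight p q r (by rw [hc.b_eq]; module)
  have dc := fun p q r => key c 0 1 (-halfHeight) p q r (by rw [hc.c_eq]; module)
  have dd := fun p q r => key d 0 (-1) (-halfHeight) p q r (by rw [hc.d_eq]; module)
  have ho : o + ((0 : ℝ) • e₁ + (0 : ℝ) • e₂ + (0 : ℝ) • e₃) = o := by module
  have hsphere : {a, b, c, d} ⊆ Metric.sphere o √(3 / 2) := by
    have aux : ∀ v, dist v o ^ 2 = 3 / 2 → v ∈ Metric.sphere o √(3 / 2) := fun v hv => by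
      rw [Metric.mem_sphere, ← hv, Real.sqrt_sq dist_nonneg]
    rintro v (rfl | rfl | rfl | rfl) <;> refine aux _ ?_
    · rw [← ho, da]; linarith
    · rw [← ho, db]; linarith
    · rw [← ho, dc]; linarith
    · rw [← ho, dd]; linarith
  have hball : convexHull ℝ s ⊆ Metric.closedBall o √(3 / 2) :=
    convexHull_min (hs'.trans (Set.union_subset Metric.ball_subset_closedBall
      (hsphere.trans Metric.sphere_subset_closedBall))) (convex_closedBall _ _)
  have hinter : convexHull ℝ s ∩ Metric.sphere o √(3 / 2) = {a, b, c, d} := by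
    refine Set.Subset.antisymm ?_ (Set.subset_inter (hs.trans (subset_convexHull ℝ s)) hsphere)
    rintro x ⟨hx, hxo⟩
    -- A point of the hull on the sphere is extreme in the ball, hence in the hull, and extreme
    -- points of a hull belong to the generating set.
    have hx1 := StrictConvexSpace.sphere_subset_extremePoints_closedBall o
      (Real.sqrt_ne_zero'.2 (by norm_num : (0 : ℝ) < 3 / 2)) hxo
    have hx2 := inter_extremePoints_subset_extremePoints_of_subset hball ⟨hx, hx1⟩
    rcases hs' (extremePoints_convexHull_subset hx2) with h1 | h1
    · exact absurd (Metric.mem_sphere.1 hxo) (Metric.mem_ball.1 h1).ne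
    · exact h1
  have hgo : g o = o := by
    have hle : ∀ v ∈ ({a, b, c, d} : Set E3), dist v (g o) ^ 2 ≤ 3 / 2 := by
      intro v hv
      have hv' := subset_convexHull ℝ s (hs hv)
      rw [← hg] at hv'
      obtain ⟨w, hw, rfl⟩ := hv'
      rw [g.dist_map, ← hρ]
      exact pow_le_pow_left₀ dist_nonneg (hball hw) 2
    obtain ⟨p, q, r, hgo⟩ := hc.exists_coords (g o)
    have ha := hle a (by simp)
    have hb := hle b (by simp)
    have hcc := hle c (by simp)
    have hd := hle d (by simp)
    rw [hgo, da] at ha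
    rw [hgo, db] at hb
    rw [hgo, dc] at hcc
    rw [hgo, dd] at hd
    -- In the sum of the four inequalities the linear terms cancel, because `o` is the centroid, and
    -- the constants balance.
    have h0 : p ^ 2 + q ^ 2 + r ^ 2 ≤ 0 := by linarith
    have hp : p = 0 := by nlinarith [sq_nonneg p, sq_nonneg q, sq_nonneg r]
    have hq : q = 0 := by nlinarith [sq_nonneg p, sq_nonneg q, sq_nonneg r]
    have hr : r = 0 := by nlinarith [sq_nonneg p, sq_nonneg q, sq_nonneg r]
    rw [hgo, hp, hq, hr, ho]
  rw [← hinter, Set.image_inter g.injective, hg, image_sphere_eq, hgo]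

/-- The isometries that permute the vertices preserve the body. -/
theorem IsRobertsBody.image_eq (h : IsRegularTetrahedron a b c d) {R : Set E3}
    (hR : IsRobertsBody a b c d R) (g : E3 ≃ᵃⁱ[ℝ] E3)
    (hg : g '' {a, b, c, d} = {a, b, c, d}) : g '' R = R := by
  have hrange : Set.range ![a, b, c, d] = {a, b, c, d} := by
    simp only [Matrix.range_cons, Matrix.range_empty, Set.union_empty, Set.singleton_union]
  have hmem : ∀ i, ∃ j, ![a, b, c, d] j = g (![a, b, c, d] i) := by
    intro i
    have : g (![a, b, c, d] i) ∈ g '' Set.range ![a, b, c, d] := ⟨_, ⟨i, rfl⟩, rfl⟩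
    rwa [hrange, hg, ← hrange] at this
  choose σ hσ using hmem
  have hne : ∀ {x y : E3}, dist x y = 2 → x ≠ y := by
    rintro x y hxy rfl
    rw [dist_self] at hxy
    exact two_ne_zero hxy.symm
  have hinj : Function.Injective ![a, b, c, d] := by
    have h1 := hne h.ab
    have h2 := hne h.ac
    have h3 := hne h.ad
    have h4 := hne h.bc
    have h5 := hne h.bd
    have h6 := hne h.cd
    intro i j hij
    fin_cases i <;> fin_cases j <;> simp_all
  have hσi : Function.Injective σ := fun i j hij => hinj (g.injective (by
    rw [← hσ, ← hσ, hij]))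
  obtain ⟨τ, rfl⟩ : ∃ τ : Equiv.Perm (Fin 4), ⇑τ = σ :=
    ⟨Equiv.ofBijective σ (Finite.injective_iff_bijective.1 hσi), rfl⟩
  have h1 := hR.map h g
  have h2 := IsRobertsBody.perm τ ![a, b, c, d] hR
  rw [hσ, hσ, hσ, hσ] at h2
  -- The image of `R` and `R` itself are both bodies of the image tetrahedron with the same
  -- labelling.
  exact (h.map g).existsUnique_isRobertsBody.unique h1 h2

end Peabody

end

/-! ### Assembly of the three assertions -/

theorem mainTheorem5 (a b c d : Peabody.E3) (habcd : Peabody.IsRegularTetrahedron a b c d) :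
    (∃! S : Peabody.ParabolicPeaPod a b × Peabody.ParabolicPeaPod c d,
      Peabody.IsConvexConfocal S.1 S.2) ∧
    (∃! R : Set Peabody.E3, Peabody.IsRobertsBody a b c d R) ∧
    (∀ R : Set Peabody.E3, Peabody.IsRobertsBody a b c d R →
      ∀ g : Peabody.E3 ≃ᵢ Peabody.E3,
        g '' R = R ↔
          g '' Peabody.tetrahedron a b c d = Peabody.tetrahedron a b c d) := by
  refine ⟨habcd.existsUnique_isConvexConfocal, habcd.existsUnique_isRobertsBody, ?_⟩
  intro R hR g
  -- By the Mazur–Ulam theorem the isometry is affine, so it commutes with convex hulls.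
  obtain ⟨φ, hφ⟩ : ∃ φ : Peabody.E3 ≃ᵃⁱ[ℝ] Peabody.E3, ⇑φ = g :=
    ⟨g.toRealAffineIsometryEquiv, g.coeFn_toRealAffineIsometryEquiv⟩
  rw [← hφ]
  constructor
  · intro h
    obtain ⟨P, rfl⟩ := hR
    have := habcd.image_vertices P.vertices_subset_surface (P.surface_subset habcd) φ h
    rw [Peabody.tetrahedron]
    conv_rhs => rw [← this]
    exact (φ.toAffineEquiv : Peabody.E3 →ᵃ[ℝ] Peabody.E3).image_convexHull _
  · intro h
    -- The same rigidity lemma, now for the vertex set alone, whose hull is the tetrahedron.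
    exact hR.image_eq habcd φ (habcd.image_vertices subset_rfl Set.subset_union_right φ h)
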